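/- Let $M\ge 1$, $0<\rho<1$ and, for $r\in\{1,\dots,M\}$, let $\mathcal M(\rho,r)$ be the set of real $M\times M$ matrices of rank at most $r$ whose largest singular value is at most $\rho$. Let $(X_t)_{t\ge1}$ be a strictly stationary $\mathbb R^M$-valued process with $X_t=AX_{t-1}+\xi_t$ for $t\ge 2$, where $A\in\mathcal M(\rho,r_0)$ for some $r_0\in\{1,\dots,M\}$, the noise vectors $(\xi_t)_{t\ge2}$ are i.i.d. and centered, and $X_1$ is independent of $(\xi_t)_{t\ge2}$. Assume that for some constants $c,d>0$ every coordinate of the noise satisfies $\mathbb E\exp(|\xi_t^{(j)}|/c)\le d$, and let $\ell:\mathbb R^M\to\mathbb R$ be $L$-Lipschitz for the Euclidean norm with $L\le 1$. Put $$\mathcal V_0=\frac{8e\,c^2d(2-\rho)}{(1-\rho)^3},\qquad \delta_0=\frac{2c}{1-\rho},$$ and assume that $n\ge 1+16\,\delta_0^2\,Mr\log(9rn)/\mathcal V_0$ for at least one $r\in\{1,\dots,M\}$. For an $M\times M$ matrix $Q$ let $$R(Q)=\mathbb E\big[\ell(X_t-QX_{t-1})\big],\qquad R_n(Q)=\frac1{n-1}\sum_{i=2}^n\ell(X_i-QX_{i-1}),$$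 where $R(Q)$ does not depend on $t\ge2$, and, for an estimator $\hat Q$ computed from the sample, $R(\hat Q)$ is the value of the function $R$ at $\hat Q$. For $r\in\{1,\dots,M\}$ let $\hat A_r$ be a minimizer of $R_n$ over $\mathcal M(\rho,r)$. Let $\bar r=\bar r(M,n)$ be the largest integer $r\le M$ such that $n\ge 1+16\,\delta_0^2\,r\log(9rn)/\mathcal V_0$, let $$\hat r\in\operatorname*{argmin}_{1\le r\le\bar r}\left[R_n(\hat A_r)+2(1+\rho)\sqrt{\frac{4\mathcal V_0M^2r\log(9rn)}{n-1}}\,\right],$$ and let $\hat A=\hat A_{\hat r}$ (ties are broken arbitrarily in both minimizations). Then for every $\eta>0$, with probability at least $1-\eta$, $$\begin{aligned}R(\hat A)\le{}&\min_{1\le r\le\bar r}\left[\min_{Q\in\mathcal M(\rho,r)}R(Q)+4(1+\rho)\sqrt{\frac{4\mathcal V_0M^2r\log(9rn)}{n-1}}\,\right]\\&+3(1+\rho)\log\left(\frac{4M}{\eta}\right)\sqrt{\frac{\mathcal V_0}{4(n-1)\log(9n)}}+\frac{\sqrt M}{n}\left(\frac{3e\,dc}{1-\rho}+\frac{\mathcal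 V_0}{2\delta_0}\right)+\frac{2\delta_0\sqrt M}{n(n-1)}\log\left(\frac2\eta\right).\end{aligned}$$ -/

import Mathlib

open MeasureTheory ProbabilityTheory
open scoped NNReal ENNReal

noncomputable section

namespace LowRankVAR

/-- `ℝ^M` with its Euclidean norm. -/
abbrev Vec (M : ℕ) : Type := EuclideanSpace ℝ (Fin M)

/-- Real `M × M` matrices. -/
abbrev Mat (M : ℕ) : Type := Matrix (Fin M) (Fin M) ℝ

/-- The action `x ↦ Q x` of a matrix on `ℝ^M`, as a continuous linear map. -/
def act {M : ℕ} (Q : Mat M) : Vec M →L[ℝ] Vec M :=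
  Matrix.toEuclideanCLM (𝕜 := ℝ) Q

/-- The Schatten-infinity norm (largest singular value), i.e. the operator norm of `Q` with
respect to the Euclidean norm. -/
def specNorm {M : ℕ} (Q : Mat M) : ℝ := ‖act Q‖

/-- The class `𝓜(ρ, r)` of matrices of rank at most `r` and of Schatten-infinity norm
at most `ρ`. -/
def lowRankSet (M : ℕ) (ρ : ℝ) (r : ℕ) : Set (Mat M) :=
  {Q | Q.rank ≤ r ∧ specNorm Q ≤ ρ}

/-- `(X_t)_{t ≥ 1}` is a stationary VAR(1) process with transition matrix `A` and noise
`(ξ_t)_{t ≥ 2}`: the noise vectors are i.i.d. and centered, the initial value `X_1` is independent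
of the noise, `X_t = A X_{t-1} + ξ_t` for `t ≥ 2`, and the law of the process is invariant
under time shifts. (`X 0`, `ξ 0` and `ξ 1` play no role.) -/
structure IsStationaryVAR {Ω : Type*} [MeasurableSpace Ω] (μ : Measure Ω) {M : ℕ} (A : Mat M)
    (ξ X : ℕ → Ω → Vec M) : Prop where
  measurable_noise : ∀ t, 2 ≤ t → Measurable (ξ t)
  measurable_init : Measurable (X 1)
  indep_noise : iIndepFun (fun t : ℕ => ξ (t + 2)) μ
  ident_noise : ∀ t, 2 ≤ t → IdentDistrib (ξ t) (ξ 2) μ μ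
  centered_noise : ∀ t, 2 ≤ t → Integrable (ξ t) μ ∧ ∫ ω, ξ t ω ∂μ = 0
  indep_init : IndepFun (X 1) (fun ω (t : ℕ) => ξ (t + 2) ω) μ
  recursion : ∀ t, 2 ≤ t → ∀ ω, X t ω = act A (X (t - 1) ω) + ξ t ω
  stationary : ∀ k : ℕ, IdentDistrib (fun ω (t : ℕ) => X (t + 1 + k) ω)
    (fun ω (t : ℕ) => X (t + 1) ω) μ μ

/-- `E exp(|ξ^{(j)}| / c) ≤ d` for every coordinate `j` (the expectation is taken in `[0, ∞]`,
so that the bound includes its finiteness). -/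
def HasExpMoment {Ω : Type*} [MeasurableSpace Ω] (μ : Measure Ω) {M : ℕ} (c d : ℝ)
    (Z : Ω → Vec M) : Prop :=
  ∀ j : Fin M, ∫⁻ ω, ENNReal.ofReal (Real.exp (|Z ω j| / c)) ∂μ ≤ ENNReal.ofReal d

/-- `𝒱₀ = 8 e c² d (2 - ρ) / (1 - ρ)³`. -/
def V₀ (ρ c d : ℝ) : ℝ := 8 * Real.exp 1 * c ^ 2 * d * (2 - ρ) / (1 - ρ) ^ 3

/-- `δ₀ = 2 c / (1 - ρ)`. -/
def δ₀ (ρ c : ℝ) : ℝ := 2 * c / (1 - ρ)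

/-- The generalization error `R(Q) = E[ℓ(X_t - Q X_{t-1})]`; it does not depend on `t ≥ 2` for a
stationary process, and `t = 2` is taken here. -/
def risk {Ω : Type*} [MeasurableSpace Ω] (μ : Measure Ω) {M : ℕ} (ℓ : Vec M → ℝ)
    (X : ℕ → Ω → Vec M) (Q : Mat M) : ℝ :=
  ∫ ω, ℓ (X 2 ω - act Q (X 1 ω)) ∂μ

/-- The empirical error `R_n(Q) = (n - 1)⁻¹ ∑_{i=2}^n ℓ(X_i - Q X_{i-1})` of a sample path
`x = (x_t)`. -/
def empRisk {M : ℕ} (ℓ : Vec M → ℝ) (n : ℕ) (x : ℕ → Vec M) (Q : Mat M) : ℝ :=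
  1 / ((n : ℝ) - 1) * ∑ i ∈ Finset.Icc 2 n, ℓ (x i - act Q (x (i - 1)))

/-- `Q` is an empirical risk minimizer over `𝓜(ρ, r)`. -/
def IsERM {M : ℕ} (ℓ : Vec M → ℝ) (n : ℕ) (x : ℕ → Vec M) (ρ : ℝ) (r : ℕ) (Q : Mat M) : Prop :=
  Q ∈ lowRankSet M ρ r ∧ IsMinOn (empRisk ℓ n x) (lowRankSet M ρ r) Q

open Classical in
/-- `r̄(M, n)`: the largest `r ∈ {1, …, M}` with `n ≥ 1 + 16 δ₀² r log(9 r n) / 𝒱₀`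
(and `0` if there is none). -/
def rBar (ρ c d : ℝ) (M n : ℕ) : ℕ :=
  ((Finset.Icc 1 M).filter fun r : ℕ =>
    (n : ℝ) ≥ 1 + 16 * δ₀ ρ c ^ 2 * r * Real.log (9 * r * n) / V₀ ρ c d).sup id

/-- The penalty `2 (1 + ρ) √(4 𝒱₀ M² r log(9 r n) / (n - 1))`. -/
def pen (ρ c d : ℝ) (M n r : ℕ) : ℝ :=
  2 * (1 + ρ) * √(4 * V₀ ρ c d * (M : ℝ) ^ 2 * r * Real.log (9 * r * n) / ((n : ℝ) - 1))

/-- `k` is a minimizer over `r ∈ {1, …, r̄(M, n)}` of the penalized criterion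
`R_n(Â_r) + pen(r)`, where `Ahat r` stands for `Â_r`. -/
def IsSelectedRank {M : ℕ} (ℓ : Vec M → ℝ) (n : ℕ) (x : ℕ → Vec M) (ρ c d : ℝ)
    (Ahat : ℕ → Mat M) (k : ℕ) : Prop :=
  k ∈ Finset.Icc 1 (rBar ρ c d M n) ∧
    ∀ r ∈ Finset.Icc 1 (rBar ρ c d M n),
      empRisk ℓ n x (Ahat k) + pen ρ c d M n k ≤ empRisk ℓ n x (Ahat r) + pen ρ c d M n r

end LowRankVAR

end

namespace LowRankVAR

set_option linter.unusedSectionVars false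

/-! The theorem is deduced from one exponential inequality for the chain, a covering of the low-rank
classes, and a deterministic comparison of empirical and true risks.

Concentration. For a law `ν` with `∫ cosh(‖x‖/τ) ≤ D` and a `K`-Lipschitz `h`, symmetrization gives
`E exp h ≤ exp(E h + u² D)` whenever `2Kτ ≤ u ≤ 1` (`integral_exp_le_of_lipschitz`). For the noise,
convexity of `z ↦ cosh √z` allows `τ = √M c` and `D = d`, so the dimension enters only through `τ`.
Integrating out the innovations one at a time, backwards in time, turns a Lipschitz additive
functional of the chain into a Lipschitz function of an earlier state; the contraction `‖A‖ ≤ ρ < 1`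
keeps all Lipschitz constants bounded (`exists_sum`). The initial state is only known to be
integrable, so stationarity is used to move the window `k` steps later: its dependence on the
initial state then carries a factor `ρ ^ k` and disappears as `k → ∞` (`measure_sum_ge_le`).

Covering. A matrix in `lowRankSet M ρ r` is a product `U C` through `ℝ^r` with `‖U‖ ≤ 1` and `‖C‖ ≤
ρ`. Nets for the two factors give a `ρ/(2n)`-net with at most `(9n)^(2Mr)` points, whose logarithm
is what the penalty pays for. Moving from the net to the class costs the average predictor norm,
which is controlled by the same exponential inequality.

Comparison. The Laplace parameter suited to rank `r` is admissible only if `2 * rate * √M * δ₀ ≤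
V₀`, which can fail for some `r ≤ rBar`. For such ranks the penalty exceeds the total oscillation of
`R - R_n` between `Q` and `0`, and the rank-one bound at `0` suffices (`risk_le_empRisk_add`). The
good event involves only nets and fixed minimizers of the risk, never the estimators, so no
measurability of the estimators matters; on it the oracle inequality is a chain of inequalities. -/

theorem cosh_mul_sub_one_le {u : ℝ} (hu₀ : 0 ≤ u) (hu₁ : u ≤ 1) (w : ℝ) :
    Real.cosh (u * w) ≤ 1 + u ^ 2 * (Real.cosh w - 1) := by
  have h := (Real.hasSum_cosh (u * w)).sub (hasSum_ite_eq 0 (1 : ℝ))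
  have h' := ((Real.hasSum_cosh w).sub (hasSum_ite_eq 0 (1 : ℝ))).mul_left (u ^ 2)
  -- Power series are compared termwise: the constant terms are removed, and `u ^ (2k) ≤ u ^ 2` for
  -- `k ≥ 1`.
  have := hasSum_le (fun k => ?_) h h'
  · linarith
  · rcases Nat.eq_zero_or_pos k with rfl | hk
    · simp
    · rw [if_neg hk.ne', sub_zero, sub_zero, mul_pow, ← mul_div_assoc]
      have : u ^ (2 * k) ≤ u ^ 2 := pow_le_pow_of_le_one hu₀ hu₁ (by omega)
      gcongr
      exact (even_two_mul k).pow_nonneg w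

/-- Convexity of `z ↦ cosh √z`: the hyperbolic cosine of a scaled Euclidean norm is at most the
average over the coordinates. -/
theorem cosh_norm_le_mean {M : ℕ} (hM : 1 ≤ M) {c : ℝ} (x : Vec M) :
    Real.cosh (‖x‖ / (√M * c)) ≤ ∑ j, (M : ℝ)⁻¹ * Real.cosh (|x j| / c) := by
  have hM0 : (M : ℝ) ≠ 0 := by positivity
  have h := Real.hasSum_cosh (‖x‖ / (√M * c))
  have h' : HasSum (fun k => ∑ j, (M : ℝ)⁻¹ * ((|x j| / c) ^ (2 * k) / (2 * k).factorial))
      (∑ j, (M : ℝ)⁻¹ * Real.cosh (|x j| / c)) :=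
    hasSum_sum fun j _ => (Real.hasSum_cosh (|x j| / c)).mul_left _
  refine hasSum_le (fun k => ?_) h h'
  have hs : (‖x‖ / (√M * c)) ^ 2 = ∑ j, (M : ℝ)⁻¹ * (|x j| / c) ^ 2 := by
    rw [div_pow, mul_pow, Real.sq_sqrt (by positivity), EuclideanSpace.norm_sq_eq,
      Finset.sum_div]
    refine Finset.sum_congr rfl fun j _ => ?_
    rw [div_pow, Real.norm_eq_abs]
    field_simp
  calc (‖x‖ / (√M * c)) ^ (2 * k) / (2 * k).factorial
      = (∑ j, (M : ℝ)⁻¹ * (|x j| / c) ^ 2) ^ k / (2 * k).factorial := by rw [pow_mul, hs]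
    _ ≤ (∑ j, (M : ℝ)⁻¹ * ((|x j| / c) ^ 2) ^ k) / (2 * k).factorial := by
        gcongr
        refine Real.pow_arith_mean_le_arith_mean_pow _ _ _ (fun _ _ => by positivity) ?_
          (fun _ _ => by positivity) k
        simp [hM0]
    _ = _ := by
        rw [Finset.sum_div]
        refine Finset.sum_congr rfl fun j _ => ?_
        rw [pow_mul, mul_div_assoc]

/-! ### Laplace transform of a Lipschitz function under a `cosh` moment. -/

section OneStep

variable {E : Type*} [NormedAddCommGroup E] [MeasurableSpace E] [BorelSpace E]

theorem continuous_of_abs_sub_le {h : E → ℝ} {K : ℝ}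
    (hh : ∀ x y, |h x - h y| ≤ K * ‖x - y‖) : Continuous h := by
  refine (LipschitzWith.of_dist_le_mul (K := K.toNNReal) fun x y => ?_).continuous
  rw [Real.dist_eq, dist_eq_norm]
  exact (hh x y).trans (by gcongr; exact Real.le_coe_toNNReal K)

variable {ν : Measure E} [IsProbabilityMeasure ν] {τ D : ℝ}

theorem norm_div_le_cosh (hτ : 0 < τ) (x : E) : ‖x‖ ≤ τ * Real.cosh (‖x‖ / τ) := by
  have h0 : 0 ≤ ‖x‖ / τ := by positivity
  have h2 : ‖x‖ / τ ≤ Real.cosh (‖x‖ / τ) := by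
    rw [Real.cosh_eq]
    nlinarith [Real.quadratic_le_exp_of_nonneg h0, Real.add_one_le_exp (-(‖x‖ / τ)),
      sq_nonneg (‖x‖ / τ / 2 - 1)]
  rwa [div_le_iff₀' hτ] at h2

theorem integrable_norm_of_cosh (hτ : 0 < τ)
    (hν : Integrable (fun x => Real.cosh (‖x‖ / τ)) ν) : Integrable (fun x => ‖x‖) ν :=
  (hν.const_mul τ).mono' continuous_norm.measurable.aestronglyMeasurable
    (.of_forall fun x => by simpa using norm_div_le_cosh hτ x)

theorem integral_norm_le_of_cosh (hτ : 0 < τ)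
    (hν : Integrable (fun x => Real.cosh (‖x‖ / τ)) ν)
    (hD : ∫ x, Real.cosh (‖x‖ / τ) ∂ν ≤ D) : ∫ x, ‖x‖ ∂ν ≤ τ * D := by
  calc ∫ x, ‖x‖ ∂ν ≤ ∫ x, τ * Real.cosh (‖x‖ / τ) ∂ν :=
        integral_mono (integrable_norm_of_cosh hτ hν) (hν.const_mul τ) (norm_div_le_cosh hτ)
    _ = τ * ∫ x, Real.cosh (‖x‖ / τ) ∂ν := integral_const_mul _ _
    _ ≤ τ * D := by gcongr

theorem integrable_of_abs_sub_le (hn : Integrable (fun x => ‖x‖) ν) {h : E → ℝ} {K : ℝ}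
    (hh : ∀ x y, |h x - h y| ≤ K * ‖x - y‖) : Integrable h ν := by
  refine ((integrable_const |h 0|).add (hn.const_mul K)).mono'
    (continuous_of_abs_sub_le hh).measurable.aestronglyMeasurable (.of_forall fun x => ?_)
  have := hh x 0
  rw [sub_zero] at this
  have h2 : |h x| ≤ |h 0| + |h x - h 0| := by
    simpa using abs_add_le (h 0) (h x - h 0)
  simp only [Pi.add_apply, Real.norm_eq_abs]
  linarith

theorem integrable_exp_of_abs_sub_le (hτ : 0 < τ)
    (hν : Integrable (fun x => Real.cosh (‖x‖ / τ)) ν) {h : E → ℝ} {K : ℝ}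
    (hh : ∀ x y, |h x - h y| ≤ K * ‖x - y‖) (hK : K * τ ≤ 1) :
    Integrable (fun x => Real.exp (h x)) ν := by
  refine (hν.const_mul (Real.exp (h 0) * 2)).mono'
    (Real.continuous_exp.comp (continuous_of_abs_sub_le hh)).measurable.aestronglyMeasurable
    (.of_forall fun x => ?_)
  have h1 := (le_abs_self _).trans (hh x 0)
  rw [sub_zero] at h1
  have h2 : K * ‖x‖ ≤ ‖x‖ / τ := by
    rw [le_div_iff₀ hτ]; nlinarith [norm_nonneg x]
  have h3 : Real.exp (‖x‖ / τ) ≤ 2 * Real.cosh (‖x‖ / τ) := by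
    rw [Real.cosh_eq]; linarith [Real.exp_pos (-(‖x‖ / τ))]
  simp only [Real.norm_eq_abs, abs_of_pos (Real.exp_pos _)]
  calc Real.exp (h x) ≤ Real.exp (h 0 + ‖x‖ / τ) := by gcongr; linarith
    _ = Real.exp (h 0) * Real.exp (‖x‖ / τ) := Real.exp_add _ _
    _ ≤ _ := by rw [mul_assoc]; gcongr

/-- Sub-exponential bound for the Laplace transform of a Lipschitz function, by symmetrization. -/
theorem integral_exp_le_of_lipschitz [SecondCountableTopology E] (hτ : 0 < τ)
    (hν : Integrable (fun x => Real.cosh (‖x‖ / τ)) ν)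
    (hD : ∫ x, Real.cosh (‖x‖ / τ) ∂ν ≤ D) {h : E → ℝ} {K u : ℝ}
    (hh : ∀ x y, |h x - h y| ≤ K * ‖x - y‖) (hK : 0 ≤ K) (hu : 2 * K * τ ≤ u) (hu₁ : u ≤ 1) :
    ∫ x, Real.exp (h x) ∂ν ≤ Real.exp (∫ x, h x ∂ν + u ^ 2 * D) := by
  have hu₀ : 0 ≤ u := le_trans (by positivity) hu
  have hKτ : K * τ ≤ 1 := by nlinarith [mul_nonneg hK hτ.le]
  have hneg : ∀ x y, |-h x - -h y| ≤ K * ‖x - y‖ := fun x y => by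
    rw [← abs_neg]; simpa [sub_eq_add_neg, add_comm] using hh x y
  have hi := integrable_exp_of_abs_sub_le hτ hν hh hKτ
  have hi' := integrable_exp_of_abs_sub_le hτ hν hneg hKτ
  have hih := integrable_of_abs_sub_le (integrable_norm_of_cosh hτ hν) hh
  set m := ∫ x, h x ∂ν with hm
  have him : Integrable (fun x => h x - m) ν := hih.sub (integrable_const _)
  have hcc : Integrable (fun x => Real.cosh (‖x‖ / τ) - 1) ν := hν.sub (integrable_const _)
  -- Jensen's inequality, by integrating the tangent line of `exp` at `-m`. It removes the
  -- independent copy at the end.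
  have hJ : Real.exp (-m) ≤ ∫ x, Real.exp (-h x) ∂ν := by
    have h1 : ∫ x, Real.exp (-m) * (1 - (h x - m)) ∂ν = Real.exp (-m) := by
      rw [integral_const_mul, integral_sub (integrable_const _) him,
        integral_sub hih (integrable_const _)]
      simp [← hm]
    rw [← h1]
    refine integral_mono
      (((integrable_const (1 : ℝ)).sub him).const_mul _) hi'
      fun x => ?_
    have := Real.add_one_le_exp (-(h x - m))
    calc Real.exp (-m) * (1 - (h x - m)) ≤ Real.exp (-m) * Real.exp (-(h x - m)) := by
          gcongr; linarith
      _ = Real.exp (-h x) := by rw [← Real.exp_add]; congr 1; ring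
  have hcv : ∀ x : E, Real.cosh (2 * K * ‖x‖) ≤ 1 + u ^ 2 * (Real.cosh (‖x‖ / τ) - 1) :=
    fun x => by
      refine le_trans ?_ (cosh_mul_sub_one_le hu₀ hu₁ _)
      rw [Real.cosh_le_cosh, abs_of_nonneg (by positivity), abs_of_nonneg (by positivity)]
      rw [← mul_div_assoc, le_div_iff₀ hτ]
      nlinarith [norm_nonneg x]
  have hci : Integrable (fun x => 1 + u ^ 2 * (Real.cosh (‖x‖ / τ) - 1)) ν :=
    (integrable_const _).add (hcc.const_mul _)
  have hpt : ∀ z : E × E, Real.exp (h z.1) * Real.exp (-h z.2) +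
      Real.exp (-h z.1) * Real.exp (h z.2) ≤
      (1 + u ^ 2 * (Real.cosh (‖z.1‖ / τ) - 1)) + (1 + u ^ 2 * (Real.cosh (‖z.2‖ / τ) - 1)) := by
    rintro ⟨x, y⟩
    refine le_trans ?_ (add_le_add (hcv x) (hcv y))
    have e1 : Real.exp (h x) * Real.exp (-h y) + Real.exp (-h x) * Real.exp (h y)
        = 2 * Real.cosh (h x - h y) := by
      rw [Real.cosh_eq, ← Real.exp_add, ← Real.exp_add]
      ring_nf
    have e2 : Real.cosh (h x - h y) ≤ Real.cosh (K * ‖x‖ + K * ‖y‖) := by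
      rw [Real.cosh_le_cosh, abs_of_nonneg (a := K * ‖x‖ + K * ‖y‖) (by positivity)]
      refine (hh x y).trans ?_
      rw [← mul_add]
      gcongr
      exact norm_sub_le x y
    -- With `p = K‖x‖ + K‖y‖` and `q = K‖x‖ - K‖y‖`, the right side is `2 cosh p cosh q`, and `cosh
    -- q ≥ 1`.
    have e3 : 2 * Real.cosh (K * ‖x‖ + K * ‖y‖) ≤
        Real.cosh (2 * K * ‖x‖) + Real.cosh (2 * K * ‖y‖) := by
      have a1 : 2 * K * ‖x‖ = (K * ‖x‖ + K * ‖y‖) + (K * ‖x‖ - K * ‖y‖) := by ring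
      have a2 : 2 * K * ‖y‖ = (K * ‖x‖ + K * ‖y‖) - (K * ‖x‖ - K * ‖y‖) := by ring
      rw [a1, a2, Real.cosh_add _ (K * ‖x‖ - K * ‖y‖), Real.cosh_sub _ (K * ‖x‖ - K * ‖y‖)]
      nlinarith [Real.one_le_cosh (K * ‖x‖ + K * ‖y‖), Real.one_le_cosh (K * ‖x‖ - K * ‖y‖)]
    simp only
    linarith
  have hint := integral_mono (μ := ν.prod ν)
    ((hi.mul_prod hi').add (hi'.mul_prod hi)) ((hci.comp_fst ν).add (hci.comp_snd ν)) hpt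
  have hl : ∫ z : E × E, Real.exp (h z.1) * Real.exp (-h z.2) +
      Real.exp (-h z.1) * Real.exp (h z.2) ∂(ν.prod ν) =
      2 * ((∫ x, Real.exp (h x) ∂ν) * ∫ x, Real.exp (-h x) ∂ν) := by
    rw [integral_add (hi.mul_prod hi') (hi'.mul_prod hi),
      integral_prod_mul (fun x => Real.exp (h x)) (fun x => Real.exp (-h x)),
      integral_prod_mul (fun x => Real.exp (-h x)) (fun x => Real.exp (h x))]
    ring
  have hr1 : ∫ x, (1 + u ^ 2 * (Real.cosh (‖x‖ / τ) - 1)) ∂ν ≤ 1 + u ^ 2 * D := by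
    rw [integral_add (integrable_const _) (hcc.const_mul _),
      integral_const_mul, integral_sub hν (integrable_const _)]
    simp only [integral_const, probReal_univ, smul_eq_mul, mul_one]
    gcongr
    linarith
  have hr : ∫ z : E × E, (1 + u ^ 2 * (Real.cosh (‖z.1‖ / τ) - 1)) +
      (1 + u ^ 2 * (Real.cosh (‖z.2‖ / τ) - 1)) ∂(ν.prod ν) ≤ 2 * (1 + u ^ 2 * D) := by
    rw [integral_add (hci.comp_fst ν) (hci.comp_snd ν),
      integral_fun_fst (fun x : E => 1 + u ^ 2 * (Real.cosh (‖x‖ / τ) - 1)),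
      integral_fun_snd (fun x : E => 1 + u ^ 2 * (Real.cosh (‖x‖ / τ) - 1))]
    simp only [probReal_univ, one_smul]
    linarith
  have hmain : (∫ x, Real.exp (h x) ∂ν) * Real.exp (-m) ≤ Real.exp (u ^ 2 * D) := by
    have h0 : 0 ≤ ∫ x, Real.exp (h x) ∂ν := integral_nonneg fun x => (Real.exp_pos _).le
    have h1 := mul_le_mul_of_nonneg_left hJ h0
    have h2 := Real.add_one_le_exp (u ^ 2 * D)
    simp only [Pi.add_apply] at hint
    rw [hl] at hint
    linarith
  rwa [Real.exp_neg, ← div_eq_mul_inv, div_le_iff₀' (Real.exp_pos m), ← Real.exp_add] at hmain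

end OneStep

/-! ### Concentration for contracting autoregressive chains. -/

section Chain

variable {Ω : Type*} {mΩ : MeasurableSpace Ω} {μ : Measure Ω} [IsProbabilityMeasure μ]
  {E : Type*} [NormedAddCommGroup E] [NormedSpace ℝ E] [MeasurableSpace E] [BorelSpace E]
  [SecondCountableTopology E]

/-- A chain `Y (k + 1) = A (Y k) + ζ k` adapted to a filtration, whose innovations `ζ k` have
law `ν` and are independent of the past. -/
structure IsARChain (μ : Measure Ω) (A : E →L[ℝ] E) (ν : Measure E) (𝓕 : Filtration ℕ mΩ)
    (Y ζ : ℕ → Ω → E) : Prop where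
  measurable_init : Measurable[𝓕 0] (Y 0)
  measurable_noise : ∀ k, Measurable[𝓕 (k + 1)] (ζ k)
  indep : ∀ k, Indep (MeasurableSpace.comap (ζ k) inferInstance) (𝓕 k) μ
  law : ∀ k, μ.map (ζ k) = ν
  step : ∀ k ω, Y (k + 1) ω = A (Y k ω) + ζ k ω

variable {A : E →L[ℝ] E} {ν : Measure E} [IsProbabilityMeasure ν] {𝓕 : Filtration ℕ mΩ}
  {Y ζ : ℕ → Ω → E}

namespace IsARChain

theorem adapted (h : IsARChain μ A ν 𝓕 Y ζ) (k : ℕ) : Measurable[𝓕 k] (Y k) := by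
  induction k with
  | zero => exact h.measurable_init
  | succ k ih =>
    have : Y (k + 1) = fun ω => A (Y k ω) + ζ k ω := funext (h.step k)
    rw [this]
    exact (A.continuous.measurable.comp (ih.mono (𝓕.mono k.le_succ) le_rfl)).add
      (h.measurable_noise k)

theorem measurable (h : IsARChain μ A ν 𝓕 Y ζ) (k : ℕ) : Measurable (Y k) :=
  (h.adapted k).mono (𝓕.le k) le_rfl

theorem measurable_noise' (h : IsARChain μ A ν 𝓕 Y ζ) (k : ℕ) : Measurable (ζ k) :=
  (h.measurable_noise k).mono (𝓕.le _) le_rfl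

theorem map_prod (h : IsARChain μ A ν 𝓕 Y ζ) {β : Type*} [MeasurableSpace β] {k : ℕ}
    {W : Ω → β} (hW : Measurable[𝓕 k] W) :
    μ.map (fun ω => (W ω, ζ k ω)) = (μ.map W).prod ν := by
  have hi : IndepFun W (ζ k) μ := by
    rw [IndepFun_iff_Indep]
    exact (indep_of_indep_of_le_right (h.indep k) hW.comap_le).symm
  rw [← h.law k]
  exact hi.map_prod_eq_prod_map_map (hW.mono (𝓕.le k) le_rfl).aemeasurable
    (h.measurable_noise' k).aemeasurable

/-- Conditioning on the past written as Fubini: `ζ k` is independent of `𝓕 k`, which carries both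
the weight and the state. The weight `Φ` makes the one-step bounds iterable. -/
theorem lintegral_mul_step (h : IsARChain μ A ν 𝓕 Y ζ) {k : ℕ} {Φ : Ω → ℝ≥0∞}
    (hΦ : Measurable[𝓕 k] Φ) {Ψ : E → E → ℝ≥0∞} (hΨ : Measurable fun p : E × E => Ψ p.1 p.2) :
    ∫⁻ ω, Φ ω * Ψ (Y k ω) (ζ k ω) ∂μ = ∫⁻ ω, Φ ω * ∫⁻ z, Ψ (Y k ω) z ∂ν ∂μ := by
  have hW : Measurable[𝓕 k] fun ω => (Φ ω, Y k ω) := hΦ.prodMk (h.adapted k)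
  have hW' := hW.mono (𝓕.le k) le_rfl
  have hG : Measurable fun p : (ℝ≥0∞ × E) × E => p.1.1 * Ψ p.1.2 p.2 :=
    (measurable_fst.comp measurable_fst).mul
      (hΨ.comp ((measurable_snd.comp measurable_fst).prodMk measurable_snd))
  calc ∫⁻ ω, Φ ω * Ψ (Y k ω) (ζ k ω) ∂μ
      = ∫⁻ p, p.1.1 * Ψ p.1.2 p.2 ∂(μ.map fun ω => ((Φ ω, Y k ω), ζ k ω)) :=
        (lintegral_map hG (hW'.prodMk (h.measurable_noise' k))).symm
    _ = ∫⁻ p, ∫⁻ z, p.1 * Ψ p.2 z ∂ν ∂(μ.map fun ω => (Φ ω, Y k ω)) := by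
        rw [h.map_prod hW, lintegral_prod _ hG.aemeasurable]
    _ = ∫⁻ ω, ∫⁻ z, Φ ω * Ψ (Y k ω) z ∂ν ∂μ :=
        lintegral_map hG.lintegral_prod_right' hW'
    _ = _ := by
        refine lintegral_congr fun ω => ?_
        exact lintegral_const_mul _ (hΨ.comp measurable_prodMk_left)

theorem integral_step (h : IsARChain μ A ν 𝓕 Y ζ) {k : ℕ} {φ : E → E → ℝ}
    (hφ : Measurable fun p : E × E => φ p.1 p.2)
    (hint : Integrable (fun ω => φ (Y k ω) (ζ k ω)) μ) :
    ∫ ω, φ (Y k ω) (ζ k ω) ∂μ = ∫ ω, ∫ z, φ (Y k ω) z ∂ν ∂μ := by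
  have hm : Measurable fun ω => (Y k ω, ζ k ω) :=
    (h.measurable k).prodMk (h.measurable_noise' k)
  have hint' : Integrable (fun p : E × E => φ p.1 p.2) (μ.map fun ω => (Y k ω, ζ k ω)) :=
    (integrable_map_measure hφ.aestronglyMeasurable hm.aemeasurable).2 hint
  have e1 : ∫ ω, φ (Y k ω) (ζ k ω) ∂μ = ∫ p, φ p.1 p.2 ∂(μ.map fun ω => (Y k ω, ζ k ω)) :=
    (integral_map hm.aemeasurable hφ.aestronglyMeasurable).symm
  rw [h.map_prod (h.adapted k)] at hint' e1
  rw [e1, integral_prod _ hint']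
  exact integral_map (h.measurable k).aemeasurable
    hφ.stronglyMeasurable.integral_prod_right'.aestronglyMeasurable

theorem integrable_norm (h : IsARChain μ A ν 𝓕 Y ζ) (hν : Integrable (fun x => ‖x‖) ν)
    (h0 : Integrable (fun ω => ‖Y 0 ω‖) μ) (k : ℕ) : Integrable (fun ω => ‖Y k ω‖) μ := by
  induction k with
  | zero => exact h0
  | succ k ih =>
    have hz : Integrable (fun ω => ‖ζ k ω‖) μ := by
      rw [← h.law k] at hν
      exact (integrable_map_measure continuous_norm.measurable.aestronglyMeasurable
        (h.measurable_noise' k).aemeasurable).1 hν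
    refine ((ih.const_mul ‖A‖).add hz).mono'
      (h.measurable (k + 1)).norm.aestronglyMeasurable (.of_forall fun ω => ?_)
    rw [norm_norm, h.step]
    exact (norm_add_le _ _).trans (add_le_add_left (A.le_opNorm _) _)

variable {τ D ρ : ℝ}

theorem continuous_uncurry {f : E → E → ℝ} {a b : ℝ}
    (hf : ∀ x y x' y', |f x y - f x' y'| ≤ a * ‖x - x'‖ + b * ‖y - y'‖) (ha : 0 ≤ a)
    (hb : 0 ≤ b) : Continuous fun p : E × E => f p.1 p.2 := by
  refine continuous_of_abs_sub_le (K := a + b) fun p q => (hf _ _ _ _).trans ?_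
  rw [add_mul]
  gcongr
  · exact norm_fst_le (p - q)
  · exact norm_snd_le (p - q)

theorem integrable_comp (h : IsARChain μ A ν 𝓕 Y ζ) (hν : Integrable (fun x => ‖x‖) ν)
    (h0 : Integrable (fun ω => ‖Y 0 ω‖) μ) {f : E → E → ℝ} {a b : ℝ}
    (hf : ∀ x y x' y', |f x y - f x' y'| ≤ a * ‖x - x'‖ + b * ‖y - y'‖) (ha : 0 ≤ a)
    (hb : 0 ≤ b) (k l : ℕ) : Integrable (fun ω => f (Y k ω) (Y l ω)) μ := by
  refine ((integrable_const |f 0 0|).add (((h.integrable_norm hν h0 k).const_mul a).add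
    ((h.integrable_norm hν h0 l).const_mul b))).mono'
    ((continuous_uncurry hf ha hb).measurable.comp
      ((h.measurable k).prodMk (h.measurable l))).aestronglyMeasurable (.of_forall fun ω => ?_)
  have h1 := hf (Y k ω) (Y l ω) 0 0
  rw [sub_zero, sub_zero] at h1
  have h2 : |f (Y k ω) (Y l ω)| ≤ |f 0 0| + |f (Y k ω) (Y l ω) - f 0 0| := by
    simpa using abs_add_le (f 0 0) (f (Y k ω) (Y l ω) - f 0 0)
  simp only [Pi.add_apply, Real.norm_eq_abs]
  linarith

/-- One step of the martingale decomposition of a Lipschitz functional of the chain. -/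
theorem exists_step (h : IsARChain μ A ν 𝓕 Y ζ) (hA : ‖A‖ ≤ ρ) (hτ : 0 < τ)
    (hν : Integrable (fun x => Real.cosh (‖x‖ / τ)) ν)
    (hD : ∫ x, Real.cosh (‖x‖ / τ) ∂ν ≤ D) (h0 : Integrable (fun ω => ‖Y 0 ω‖) μ)
    {f : E → E → ℝ} {a b : ℝ}
    (hf : ∀ x y x' y', |f x y - f x' y'| ≤ a * ‖x - x'‖ + b * ‖y - y'‖) (ha : 0 ≤ a)
    (hb : 0 ≤ b) {g : E → ℝ} {L u : ℝ} (hg : ∀ x y, |g x - g y| ≤ L * ‖x - y‖) (hL : 0 ≤ L)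
    (hu : 2 * (a + L) * τ ≤ u) (hu₁ : u ≤ 1) :
    ∃ g' : E → ℝ, (∀ x y, |g' x - g' y| ≤ (a * ρ + b + L * ρ) * ‖x - y‖) ∧ ∀ t,
      (∀ Φ : Ω → ℝ≥0∞, Measurable[𝓕 t] Φ →
        ∫⁻ ω, Φ ω * ENNReal.ofReal
          (Real.exp (f (Y (t + 1) ω) (Y t ω) + g (Y (t + 1) ω))) ∂μ ≤
        ENNReal.ofReal (Real.exp (u ^ 2 * D)) *
          ∫⁻ ω, Φ ω * ENNReal.ofReal (Real.exp (g' (Y t ω))) ∂μ) ∧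
      ∫ ω, (f (Y (t + 1) ω) (Y t ω) + g (Y (t + 1) ω)) ∂μ = ∫ ω, g' (Y t ω) ∂μ := by
  have hνn := integrable_norm_of_cosh hτ hν
  have hρ : 0 ≤ ρ := (norm_nonneg A).trans hA
  set φ : E → E → ℝ := fun y z => f (A y + z) y + g (A y + z) with hφ
  have hφz : ∀ y z z', |φ y z - φ y z'| ≤ (a + L) * ‖z - z'‖ := fun y z z' => by
    have h1 := hf (A y + z) y (A y + z') y
    have h2 := hg (A y + z) (A y + z')
    rw [add_sub_add_left_eq_sub] at h1 h2
    rw [sub_self, norm_zero, mul_zero, add_zero] at h1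
    calc |φ y z - φ y z'| = |(f (A y + z) y - f (A y + z') y) + (g (A y + z) - g (A y + z'))| := by
          simp only [hφ]; ring_nf
      _ ≤ _ := (abs_add_le _ _).trans (by rw [add_mul]; exact add_le_add h1 h2)
  have hφy : ∀ z y y', |φ y z - φ y' z| ≤ (a * ρ + b + L * ρ) * ‖y - y'‖ := fun z y y' => by
    have h1 := hf (A y + z) y (A y' + z) y'
    have h2 := hg (A y + z) (A y' + z)
    rw [add_sub_add_right_eq_sub, ← map_sub] at h1 h2
    have h3 : ‖A (y - y')‖ ≤ ρ * ‖y - y'‖ := (A.le_opNorm _).trans (by gcongr)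
    calc |φ y z - φ y' z| = |(f (A y + z) y - f (A y' + z) y') + (g (A y + z) - g (A y' + z))| := by
          simp only [hφ]; ring_nf
      _ ≤ _ := abs_add_le _ _
      _ ≤ (a * ‖A (y - y')‖ + b * ‖y - y'‖) + L * ‖A (y - y')‖ := add_le_add h1 h2
      _ ≤ (a * (ρ * ‖y - y'‖) + b * ‖y - y'‖) + L * (ρ * ‖y - y'‖) := by gcongr
      _ = _ := by ring
  have hcont : Continuous fun p : E × E => φ p.1 p.2 := by
    have hp : Continuous fun p : E × E => A p.1 + p.2 := by fun_prop
    exact ((continuous_uncurry hf ha hb).comp (hp.prodMk continuous_fst)).add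
      ((continuous_of_abs_sub_le hg).comp hp)
  have hφi : ∀ y, Integrable (φ y) ν := fun y => integrable_of_abs_sub_le hνn (hφz y)
  -- The witness is the conditional mean of the functional given the state `y` at time `t`.
  refine ⟨fun y => ∫ z, φ y z ∂ν, fun x y => ?_, fun t => ⟨fun Φ hΦ => ?_, ?_⟩⟩
  · rw [← integral_sub (hφi x) (hφi y)]
    have := norm_integral_le_of_norm_le_const (μ := ν)
      (.of_forall fun z => hφy z x y : ∀ᵐ z ∂ν, ‖φ x z - φ y z‖ ≤ _)
    simpa using this
  · have e1 : ∀ ω, f (Y (t + 1) ω) (Y t ω) + g (Y (t + 1) ω) = φ (Y t ω) (ζ t ω) := fun ω => by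
      simp only [hφ, h.step]
    simp_rw [e1]
    rw [h.lintegral_mul_step hΦ (Ψ := fun y z => ENNReal.ofReal (Real.exp (φ y z)))
      (ENNReal.measurable_ofReal.comp (Real.continuous_exp.comp hcont).measurable)]
    have hmeas : Measurable fun ω => Φ ω * ENNReal.ofReal (Real.exp (∫ z, φ (Y t ω) z ∂ν)) :=
      (hΦ.mono (𝓕.le t) le_rfl).mul (ENNReal.measurable_ofReal.comp (Real.measurable_exp.comp
        (hcont.measurable.stronglyMeasurable.integral_prod_right'.measurable.comp
          (h.measurable t))))
    rw [← lintegral_const_mul _ hmeas]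
    refine lintegral_mono fun ω => ?_
    rw [mul_left_comm]
    refine mul_le_mul_right ?_ _
    have hKτ : (a + L) * τ ≤ 1 := by
      have : 0 ≤ (a + L) * τ := by positivity
      linarith
    rw [← ofReal_integral_eq_lintegral_ofReal
      (integrable_exp_of_abs_sub_le hτ hν (hφz _) hKτ) (.of_forall fun z => (Real.exp_pos _).le),
      ← ENNReal.ofReal_mul (Real.exp_pos _).le, ← Real.exp_add]
    refine ENNReal.ofReal_le_ofReal ?_
    rw [add_comm]
    exact integral_exp_le_of_lipschitz hτ hν hD (hφz _) (by positivity) hu hu₁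
  · have e1 : (fun ω => f (Y (t + 1) ω) (Y t ω) + g (Y (t + 1) ω)) =
        fun ω => φ (Y t ω) (ζ t ω) := funext fun ω => by simp only [hφ, h.step]
    have hi : Integrable (fun ω => f (Y (t + 1) ω) (Y t ω) + g (Y (t + 1) ω)) μ :=
      (h.integrable_comp hνn h0 hf ha hb _ _).add
        (h.integrable_comp hνn h0 (f := fun x _ => g x) (a := L) (b := 0)
          (fun x y x' y' => by simpa using hg x x') hL le_rfl (t + 1) (t + 1))
    rw [e1] at hi ⊢
    exact h.integral_step hcont.measurable hi

/-- The constant `(a * ρ + b) / (1 - ρ)` is the fixed point of the one-step map `L ↦ a * ρ + b + L *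
ρ`, so it is preserved at every backward step. Adding `a` gives `(a + b) / (1 - ρ)`, the sensitivity
to a single innovation, hence the condition on `u`. -/
theorem exists_sum (h : IsARChain μ A ν 𝓕 Y ζ) (hA : ‖A‖ ≤ ρ) (hρ : ρ < 1) (hτ : 0 < τ)
    (hν : Integrable (fun x => Real.cosh (‖x‖ / τ)) ν)
    (hD : ∫ x, Real.cosh (‖x‖ / τ) ∂ν ≤ D) (h0 : Integrable (fun ω => ‖Y 0 ω‖) μ)
    {f : E → E → ℝ} {a b u : ℝ}
    (hf : ∀ x y x' y', |f x y - f x' y'| ≤ a * ‖x - x'‖ + b * ‖y - y'‖) (ha : 0 ≤ a)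
    (hb : 0 ≤ b) (hu : 2 * ((a + b) / (1 - ρ)) * τ ≤ u) (hu₁ : u ≤ 1) (k : ℕ) :
    ∃ g : E → ℝ, (∀ x y, |g x - g y| ≤ (a * ρ + b) / (1 - ρ) * ‖x - y‖) ∧ ∀ t,
      (∀ Φ : Ω → ℝ≥0∞, Measurable[𝓕 t] Φ →
        ∫⁻ ω, Φ ω * ENNReal.ofReal
          (Real.exp (∑ j ∈ Finset.range k, f (Y (t + j + 1) ω) (Y (t + j) ω))) ∂μ ≤
        ENNReal.ofReal (Real.exp (k * (u ^ 2 * D))) *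
          ∫⁻ ω, Φ ω * ENNReal.ofReal (Real.exp (g (Y t ω))) ∂μ) ∧
      ∫ ω, ∑ j ∈ Finset.range k, f (Y (t + j + 1) ω) (Y (t + j) ω) ∂μ = ∫ ω, g (Y t ω) ∂μ := by
  have hρ0 : 0 ≤ ρ := (norm_nonneg A).trans hA
  have h1ρ : 0 < 1 - ρ := by linarith
  have hνn := integrable_norm_of_cosh hτ hν
  have hL : 0 ≤ (a * ρ + b) / (1 - ρ) := by positivity
  induction k with
  | zero =>
    refine ⟨fun _ => 0, fun x y => by simpa using by positivity, fun t => ⟨fun Φ _ => ?_, ?_⟩⟩ <;>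
      simp
  | succ k ih =>
    obtain ⟨g, hg, hgt⟩ := ih
    have hK : a + (a * ρ + b) / (1 - ρ) = (a + b) / (1 - ρ) := by field_simp; ring
    obtain ⟨g', hg', hgt'⟩ := h.exists_step hA hτ hν hD h0 hf ha hb hg hL (by rwa [hK]) hu₁
    refine ⟨g', fun x y => (hg' x y).trans_eq (by field_simp; ring), fun t => ?_⟩
    have es : ∀ ω, ∑ j ∈ Finset.range (k + 1), f (Y (t + j + 1) ω) (Y (t + j) ω) =
        f (Y (t + 1) ω) (Y t ω) +
          ∑ j ∈ Finset.range k, f (Y (t + 1 + j + 1) ω) (Y (t + 1 + j) ω) := fun ω => by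
      rw [Finset.sum_range_succ', add_comm]
      simp only [add_zero]
      congr 1
      refine Finset.sum_congr rfl fun j _ => ?_
      rw [show t + (j + 1) = t + 1 + j by omega]
    simp_rw [es]
    refine ⟨fun Φ hΦ => ?_, ?_⟩
    -- The first summand is known at time `t + 1`; it joins the weight while the later summands are
    -- integrated out.
    · have hΦ' : Measurable[𝓕 (t + 1)] fun ω => Φ ω *
          ENNReal.ofReal (Real.exp (f (Y (t + 1) ω) (Y t ω))) :=
        (hΦ.mono (𝓕.mono t.le_succ) le_rfl).mul
          ((ENNReal.measurable_ofReal.comp (Real.continuous_exp.comp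
            (continuous_uncurry hf ha hb)).measurable).comp
            ((h.adapted (t + 1)).prodMk ((h.adapted t).mono (𝓕.mono t.le_succ) le_rfl)))
      have h1 := (hgt (t + 1)).1 _ hΦ'
      simp_rw [mul_assoc, ← ENNReal.ofReal_mul (Real.exp_pos _).le, ← Real.exp_add] at h1
      refine h1.trans ((mul_le_mul_right ((hgt' t).1 Φ hΦ) _).trans_eq ?_)
      rw [← mul_assoc, ← ENNReal.ofReal_mul (Real.exp_pos _).le, ← Real.exp_add]
      congr 3
      push_cast
      ring
    · have hif : ∀ i j, Integrable (fun ω => f (Y i ω) (Y j ω)) μ :=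
        fun i j => h.integrable_comp hνn h0 hf ha hb i j
      have hig : Integrable (fun ω => g (Y (t + 1) ω)) μ :=
        h.integrable_comp hνn h0 (f := fun x _ => g x) (b := 0)
          (fun x y x' y' => by simpa using hg x x') hL le_rfl (t + 1) (t + 1)
      rw [← (hgt' t).2, integral_add (hif _ _) (integrable_finsetSum _ fun j _ => hif _ _),
        (hgt (t + 1)).2, integral_add (hif _ _) hig]

/-- Each backward step multiplies the Lipschitz constant, and with it `u`, by `ρ`. The successive
costs `u² D`, `ρ² u² D`, … have a sum that `u² D / (1 - ρ)` dominates whatever `k` is. -/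
theorem exists_burn_in (h : IsARChain μ A ν 𝓕 Y ζ) (hA : ‖A‖ ≤ ρ) (hρ : ρ < 1) (hτ : 0 < τ)
    (hν : Integrable (fun x => Real.cosh (‖x‖ / τ)) ν)
    (hD : ∫ x, Real.cosh (‖x‖ / τ) ∂ν ≤ D) (hD0 : 0 ≤ D) (h0 : Integrable (fun ω => ‖Y 0 ω‖) μ)
    (k : ℕ) {g : E → ℝ} {L u : ℝ} (hg : ∀ x y, |g x - g y| ≤ L * ‖x - y‖) (hL : 0 ≤ L)
    (hu : 2 * L * τ ≤ u) (hu₁ : u ≤ 1) :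
    ∃ g' : E → ℝ, (∀ x y, |g' x - g' y| ≤ (ρ ^ k * L) * ‖x - y‖) ∧
      (∀ Φ : Ω → ℝ≥0∞, Measurable[𝓕 0] Φ →
        ∫⁻ ω, Φ ω * ENNReal.ofReal (Real.exp (g (Y k ω))) ∂μ ≤
        ENNReal.ofReal (Real.exp (u ^ 2 * D / (1 - ρ))) *
          ∫⁻ ω, Φ ω * ENNReal.ofReal (Real.exp (g' (Y 0 ω))) ∂μ) ∧
      ∫ ω, g (Y k ω) ∂μ = ∫ ω, g' (Y 0 ω) ∂μ := by
  have hρ0 : 0 ≤ ρ := (norm_nonneg A).trans hA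
  have h1ρ : 0 < 1 - ρ := by linarith
  induction k generalizing g L u with
  | zero =>
    refine ⟨g, by simpa using hg, fun Φ _ => ?_, rfl⟩
    refine le_mul_of_one_le_left (zero_le) ?_
    rw [ENNReal.one_le_ofReal]
    exact Real.one_le_exp (by positivity)
  | succ k ih =>
    have hu0 : 0 ≤ u := le_trans (by positivity) hu
    obtain ⟨g₁, hg₁, hgt₁⟩ := h.exists_step hA hτ hν hD h0 (f := fun _ _ => 0) (a := 0) (b := 0)
      (by simp) le_rfl le_rfl hg hL (by simpa using hu) hu₁
    obtain ⟨g₂, hg₂, hgt₂, hm⟩ := ih (g := g₁) (L := L * ρ) (u := ρ * u)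
      (fun x y => by simpa using hg₁ x y) (by positivity) (by nlinarith) (by nlinarith)
    refine ⟨g₂, fun x y => (hg₂ x y).trans_eq (by ring), fun Φ hΦ => ?_, ?_⟩
    · have h1 := (hgt₁ k).1 Φ (hΦ.mono (𝓕.mono (Nat.zero_le k)) le_rfl)
      simp only [zero_add] at h1
      refine h1.trans ((mul_le_mul_right (hgt₂ Φ hΦ) _).trans ?_)
      rw [← mul_assoc, ← ENNReal.ofReal_mul (Real.exp_pos _).le, ← Real.exp_add]
      gcongr
      rw [le_div_iff₀ h1ρ, add_mul, div_mul_cancel₀ _ h1ρ.ne']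
      have : 0 ≤ u ^ 2 * D * (ρ * (1 - ρ)) := by positivity
      nlinarith
    · have h1 := (hgt₁ k).2
      simp only [zero_add] at h1
      rw [h1, hm]

/-- Exponential deviation inequality for additive functionals of a stationary chain. -/
theorem measure_sum_ge_le (h : IsARChain μ A ν 𝓕 Y ζ) (hA : ‖A‖ ≤ ρ) (hρ : ρ < 1) (hτ : 0 < τ)
    (hν : Integrable (fun x => Real.cosh (‖x‖ / τ)) ν)
    (hD : ∫ x, Real.cosh (‖x‖ / τ) ∂ν ≤ D) (h0 : Integrable (fun ω => ‖Y 0 ω‖) μ)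
    (hstat : ∀ k : ℕ, IdentDistrib (fun ω (t : ℕ) => Y (t + k) ω) (fun ω (t : ℕ) => Y t ω) μ μ)
    {f : E → E → ℝ} {a b u : ℝ}
    (hf : ∀ x y x' y', |f x y - f x' y'| ≤ a * ‖x - x'‖ + b * ‖y - y'‖) (ha : 0 ≤ a)
    (hb : 0 ≤ b) (hu : 2 * ((a + b) / (1 - ρ)) * τ ≤ u) (hu₁ : u ≤ 1) (N : ℕ) (x : ℝ) :
    μ {ω | N * ∫ ω, f (Y 1 ω) (Y 0 ω) ∂μ + x ≤
        ∑ j ∈ Finset.range N, f (Y (j + 1) ω) (Y j ω)} ≤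
      ENNReal.ofReal (Real.exp (-x + u ^ 2 * D * (N + 1 / (1 - ρ)))) := by
  have hρ0 : 0 ≤ ρ := (norm_nonneg A).trans hA
  have h1ρ : 0 < 1 - ρ := by linarith
  have hνn := integrable_norm_of_cosh hτ hν
  have hD0 : 0 ≤ D := (integral_nonneg fun x => (Real.cosh_pos _).le).trans hD
  have hu0 : 0 ≤ u := le_trans (by positivity) hu
  have hif : ∀ i j, Integrable (fun ω => f (Y i ω) (Y j ω)) μ :=
    fun i j => h.integrable_comp hνn h0 hf ha hb i j
  set lam := (a * ρ + b) / (1 - ρ) with hlam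
  have hL : 0 ≤ lam := by positivity
  have hLu : 2 * lam * τ ≤ u := by
    refine le_trans ?_ hu
    rw [hlam]
    gcongr
    nlinarith
  set e := N * ∫ ω, f (Y 1 ω) (Y 0 ω) ∂μ with he
  set n0 := ∫ ω, ‖Y 0 ω‖ ∂μ with hn0
  set F : (ℕ → E) → ℝ := fun y => ∑ j ∈ Finset.range N, f (y (j + 1)) (y j) with hF
  have hfm : ∀ i j, Measurable fun y : ℕ → E => f (y i) (y j) := fun i j => by
    have hp : Measurable fun y : ℕ → E => (y i, y j) :=
      (measurable_pi_apply i).prodMk (measurable_pi_apply j)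
    exact (continuous_uncurry hf ha hb).measurable.comp hp
  have hFm : Measurable F := by
    exact Finset.measurable_fun_sum _ fun j _ => hfm (j + 1) j
  have hFe : ∫ ω, F (fun t => Y t ω) ∂μ = e := by
    simp only [hF]
    rw [integral_finsetSum _ fun j _ => hif _ _]
    have : ∀ j, ∫ ω, f (Y (j + 1) ω) (Y j ω) ∂μ = ∫ ω, f (Y 1 ω) (Y 0 ω) ∂μ := fun j => by
      have := ((hstat j).comp (u := fun y => f (y 1) (y 0))
        (hfm 1 0)).integral_eq
      simpa [Function.comp_def, add_comm] using this
    simp [this, he]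
  obtain ⟨g, hg, hgt⟩ := h.exists_sum hA hρ hτ hν hD h0 hf ha hb hu hu₁ N
  -- The window is moved to start at time `k`. On `‖Y 0‖ ≤ K` the remaining function of `Y 0`
  -- exceeds its mean `e` by at most `ρ ^ k * lam * (K + n0)`; the indicator of this set serves as
  -- the weight `Φ`, so no exponential moment of `Y 0` is needed.
  have key : ∀ k K : ℕ, μ {ω | e + x ≤ F fun t => Y t ω} ≤ μ {ω | (K : ℝ) < ‖Y 0 ω‖} +
      ENNReal.ofReal (Real.exp (-x + u ^ 2 * D * (N + 1 / (1 - ρ)) +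
        ρ ^ k * (lam * (K + n0)))) := by
    intro k K
    obtain ⟨g', hg', hgt', hm'⟩ := h.exists_burn_in hA hρ hτ hν hD hD0 h0 k hg hL hLu hu₁
    have hid := (hstat k).comp hFm
    have hmean : ∫ ω, g' (Y 0 ω) ∂μ = e := by
      rw [← hm', ← (hgt k).2, ← hFe]
      have := hid.integral_eq
      simp only [Function.comp_def, hF] at this
      rw [← this]
      refine integral_congr_ae (.of_forall fun ω => ?_)
      refine Finset.sum_congr rfl fun j _ => ?_
      rw [show k + j + 1 = j + 1 + k by omega, add_comm k j]
    have hg'le : ∀ ω, g' (Y 0 ω) ≤ e + ρ ^ k * lam * (‖Y 0 ω‖ + n0) := fun ω => by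
      have hi : Integrable (fun ω => g' (Y 0 ω)) μ :=
        h.integrable_comp hνn h0 (f := fun x _ => g' x) (b := 0)
          (fun x y x' y' => by simpa using hg' x x') (by positivity) le_rfl 0 0
      have h1 : ∫ ω', (g' (Y 0 ω) - g' (Y 0 ω')) ∂μ ≤
          ∫ ω', ρ ^ k * lam * (‖Y 0 ω‖ + ‖Y 0 ω'‖) ∂μ := by
        refine integral_mono ((integrable_const _).sub hi)
          (((integrable_const _).add h0).const_mul _) fun ω' => ?_
        refine (le_abs_self _).trans ((hg' _ _).trans ?_)
        gcongr
        exact norm_sub_le _ _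
      rw [integral_sub (integrable_const _) hi, integral_const_mul,
        integral_add (integrable_const _) h0, hmean] at h1
      simp only [integral_const, probReal_univ, one_smul] at h1
      linarith
    have hY0 : Measurable[𝓕 0] (Y 0) := h.measurable_init
    have hBm : MeasurableSet[𝓕 0] {ω | ‖Y 0 ω‖ ≤ K} :=
      hY0 (measurableSet_le continuous_norm.measurable measurable_const :
        MeasurableSet {y : E | ‖y‖ ≤ K})
    set B : Set Ω := {ω | ‖Y 0 ω‖ ≤ K} with hB
    have hΦ : Measurable[𝓕 0] (B.indicator fun _ => (1 : ℝ≥0∞)) :=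
      (measurable_const).indicator hBm
    have e1 : μ {ω | e + x ≤ F fun t => Y t ω} = μ {ω | e + x ≤ F fun t => Y (t + k) ω} := by
      have := hid.measure_mem_eq (s := Set.Ici (e + x)) measurableSet_Ici
      exact this.symm
    have hlap : ∫⁻ ω, B.indicator (fun _ => (1 : ℝ≥0∞)) ω *
        ENNReal.ofReal (Real.exp (F fun t => Y (t + k) ω)) ∂μ ≤
        ENNReal.ofReal (Real.exp (N * (u ^ 2 * D) + u ^ 2 * D / (1 - ρ) + e +
          ρ ^ k * lam * (K + n0))) := by
      have h1 := (hgt k).1 _ (hΦ.mono (𝓕.mono (Nat.zero_le k)) le_rfl)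
      have h2 := hgt' _ hΦ
      have h3 : ∫⁻ ω, B.indicator (fun _ => (1 : ℝ≥0∞)) ω *
          ENNReal.ofReal (Real.exp (g' (Y 0 ω))) ∂μ ≤
          ENNReal.ofReal (Real.exp (e + ρ ^ k * lam * (K + n0))) := by
        calc _ ≤ ∫⁻ _ω, ENNReal.ofReal (Real.exp (e + ρ ^ k * lam * (K + n0))) ∂μ := by
              refine lintegral_mono fun ω => ?_
              by_cases hω : ω ∈ B
              · rw [Set.indicator_of_mem hω, one_mul]
                gcongr
                refine (hg'le ω).trans ?_
                gcongr
                exact hω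
              · rw [Set.indicator_of_notMem hω, zero_mul]
                exact zero_le
          _ = _ := by simp
      have h4 := h1.trans (mul_le_mul_right (h2.trans (mul_le_mul_right h3 _)) _)
      rw [← ENNReal.ofReal_mul (Real.exp_pos _).le, ← ENNReal.ofReal_mul (Real.exp_pos _).le,
        ← Real.exp_add, ← Real.exp_add] at h4
      refine le_trans (le_of_eq ?_) (h4.trans_eq ?_)
      · refine lintegral_congr fun ω => ?_
        congr 3
        refine Finset.sum_congr rfl fun j _ => ?_
        rw [show k + j + 1 = j + 1 + k by omega, add_comm k j]
      · congr 2
        ring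
    rw [e1]
    have hsub : {ω | e + x ≤ F fun t => Y (t + k) ω} ⊆ {ω | (K : ℝ) < ‖Y 0 ω‖} ∪
        {ω | ENNReal.ofReal (Real.exp (e + x)) ≤ B.indicator (fun _ => (1 : ℝ≥0∞)) ω *
          ENNReal.ofReal (Real.exp (F fun t => Y (t + k) ω))} := by
      intro ω hω
      by_cases hωB : ω ∈ B
      · right
        simp only [Set.mem_ofPred_eq, Set.indicator_of_mem hωB, one_mul]
        gcongr
        exact hω
      · left
        exact lt_of_not_ge (show ¬ ‖Y 0 ω‖ ≤ K from hωB)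
    refine (measure_mono hsub).trans ((measure_union_le _ _).trans ?_)
    gcongr
    have hmk := mul_meas_ge_le_lintegral (μ := μ) (f := fun ω => B.indicator (fun _ => (1 : ℝ≥0∞)) ω *
          ENNReal.ofReal (Real.exp (F fun t => Y (t + k) ω)))
      ((hΦ.mono (𝓕.le 0) le_rfl).mul (ENNReal.measurable_ofReal.comp (Real.measurable_exp.comp
        (hFm.comp (measurable_pi_lambda _ fun t => h.measurable (t + k))))))
      (ENNReal.ofReal (Real.exp (e + x)))
    have h5 := mul_le_mul_right (hmk.trans hlap) (ENNReal.ofReal (Real.exp (-(e + x))))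
    rw [← mul_assoc, ← ENNReal.ofReal_mul (Real.exp_pos _).le,
      ← ENNReal.ofReal_mul (Real.exp_pos _).le, ← Real.exp_add, ← Real.exp_add] at h5
    simp only [neg_add_cancel, Real.exp_zero, ENNReal.ofReal_one, one_mul] at h5
    refine h5.trans_eq ?_
    congr 2
    field_simp
    ring
  -- First `k → ∞` at fixed `K`, then `K → ∞`; the order matters because `K` multiplies `ρ ^ k`.
  have step1 : ∀ K : ℕ, μ {ω | e + x ≤ F fun t => Y t ω} ≤ μ {ω | (K : ℝ) < ‖Y 0 ω‖} +
      ENNReal.ofReal (Real.exp (-x + u ^ 2 * D * (N + 1 / (1 - ρ)))) := fun K => by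
    refine ge_of_tendsto' (x := Filter.atTop) ?_ (fun k => key k K)
    refine tendsto_const_nhds.add ((ENNReal.continuous_ofReal.comp Real.continuous_exp).continuousAt.tendsto.comp ?_)
    have := ((tendsto_pow_atTop_nhds_zero_of_lt_one hρ0 hρ).mul_const (lam * (K + n0))).const_add
      (-x + u ^ 2 * D * (N + 1 / (1 - ρ)))
    simpa using this
  refine ge_of_tendsto' (x := Filter.atTop) ?_ step1
  have hz : Filter.Tendsto (fun K : ℕ => μ {ω | (K : ℝ) < ‖Y 0 ω‖}) Filter.atTop (nhds 0) := by
    have hinter : (⋂ K : ℕ, {ω | (K : ℝ) < ‖Y 0 ω‖}) = ∅ := by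
      ext ω
      simp only [Set.mem_iInter, Set.mem_ofPred_eq, Set.mem_empty_iff_false, iff_false, not_forall,
        not_lt]
      exact exists_nat_ge _
    rw [← measure_empty (μ := μ), ← hinter]
    refine tendsto_measure_iInter_atTop (fun K => ?_) (fun K K' hK ω hω => ?_) ⟨0, by finiteness⟩
    · exact (measurableSet_lt measurable_const (h.measurable 0).norm).nullMeasurableSet
    · exact lt_of_le_of_lt (Nat.cast_le.2 hK) (show (K' : ℝ) < ‖Y 0 ω‖ from hω)
  simpa using hz.add_const (ENNReal.ofReal (Real.exp (-x + u ^ 2 * D * (N + 1 / (1 - ρ)))))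

end IsARChain

end Chain

/-! ### Covering numbers of balls in finite dimension. -/

section Nets

variable {V : Type*} [NormedAddCommGroup V] [NormedSpace ℝ V] [FiniteDimensional ℝ V]

/-- Volume comparison: the balls of radius `δ / 2` around the points are disjoint and lie in the
ball of radius `R + δ / 2`. -/
theorem card_le_of_separated {R δ : ℝ} (hR : 0 < R) (hδ : 0 < δ) (s : Finset V)
    (hs : ∀ c ∈ s, ‖c‖ ≤ R) (h : ∀ c ∈ s, ∀ d ∈ s, c ≠ d → δ ≤ ‖c - d‖) :
    (s.card : ℝ) ≤ (1 + 2 * R / δ) ^ Module.finrank ℝ V := by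
  borelize V
  let μ : Measure V := Measure.addHaar
  have hδ2 : 0 < δ / 2 := by positivity
  have hRδ : 0 < R + δ / 2 := by positivity
  have hdisj : Set.Pairwise (s : Set V) (Function.onFun Disjoint fun c => Metric.ball c (δ / 2)) := by
    rintro c hc d hd hcd
    apply Metric.ball_disjoint_ball
    rw [dist_eq_norm, add_halves]
    exact h c hc d hd hcd
  have hsub : (⋃ c ∈ s, Metric.ball (c : V) (δ / 2)) ⊆ Metric.ball (0 : V) (R + δ / 2) := by
    refine Set.iUnion₂_subset fun x hx => Metric.ball_subset_ball' ?_
    rw [dist_zero_right]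
    linarith [hs x hx]
  have hvol : (s.card : ℝ≥0∞) * ENNReal.ofReal ((δ / 2) ^ Module.finrank ℝ V) *
      μ (Metric.ball 0 1) ≤
      ENNReal.ofReal ((R + δ / 2) ^ Module.finrank ℝ V) * μ (Metric.ball 0 1) :=
    calc _ = μ (⋃ c ∈ s, Metric.ball (c : V) (δ / 2)) := by
          rw [measure_biUnion_finset hdisj fun c _ => measurableSet_ball]
          simp only [μ.addHaar_ball_of_pos _ hδ2, Finset.sum_const, nsmul_eq_mul, mul_assoc]
      _ ≤ μ (Metric.ball (0 : V) (R + δ / 2)) := measure_mono hsub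
      _ = _ := by simp only [μ.addHaar_ball_of_pos _ hRδ]
  have hcard := (ENNReal.mul_le_mul_iff_left
    (Metric.measure_ball_pos μ _ zero_lt_one).ne' measure_ball_lt_top.ne).1 hvol
  have hreal := ENNReal.toReal_le_of_le_ofReal (pow_nonneg hRδ.le _) hcard
  rw [ENNReal.toReal_mul, ENNReal.toReal_natCast, ENNReal.toReal_ofReal (by positivity),
    ← le_div_iff₀ (by positivity), ← div_pow] at hreal
  refine hreal.trans_eq ?_
  congr 1
  field_simp
  ring

/-- A separated subset of maximal cardinality is a net; the volume bound ensures that a maximum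
exists. -/
theorem exists_net_closedBall {R δ : ℝ} (hR : 0 < R) (hδ : 0 < δ) :
    ∃ s : Finset V, (∀ c ∈ s, ‖c‖ ≤ R) ∧ (∀ x, ‖x‖ ≤ R → ∃ c ∈ s, ‖x - c‖ ≤ δ) ∧
      (s.card : ℝ) ≤ (1 + 2 * R / δ) ^ Module.finrank ℝ V := by
  classical
  let P : ℕ → Prop := fun k => ∃ s : Finset V, (∀ c ∈ s, ‖c‖ ≤ R) ∧
    (∀ c ∈ s, ∀ d ∈ s, c ≠ d → δ ≤ ‖c - d‖) ∧ s.card = k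
  let b := ⌊(1 + 2 * R / δ) ^ Module.finrank ℝ V⌋₊
  have hP : ∀ k, P k → k ≤ b := by
    rintro k ⟨s, h1, h2, rfl⟩
    exact Nat.le_floor (card_le_of_separated hR hδ s h1 h2)
  have hP0 : P 0 := ⟨∅, by simp⟩
  obtain ⟨s, h1, h2, h3⟩ : P (Nat.findGreatest P b) := Nat.findGreatest_spec (Nat.zero_le b) hP0
  refine ⟨s, h1, fun x hx => ?_, card_le_of_separated hR hδ s h1 h2⟩
  by_contra! hfar
  have hxs : x ∉ s := fun hxs => by
    have := hfar x hxs
    rw [sub_self, norm_zero] at this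
    exact absurd this (not_lt.2 hδ.le)
  have hP1 : P (s.card + 1) := by
    refine ⟨insert x s, ?_, ?_, Finset.card_insert_of_notMem hxs⟩
    · intro c hc
      rcases Finset.mem_insert.1 hc with rfl | hc
      exacts [hx, h1 c hc]
    · intro c hc d hd hcd
      rcases Finset.mem_insert.1 hc with rfl | hc' <;> rcases Finset.mem_insert.1 hd with rfl | hd'
      · exact absurd rfl hcd
      · exact (hfar d hd').le
      · rw [norm_sub_rev]; exact (hfar c hc').le
      · exact h2 c hc' d hd' hcd
  have := Nat.le_findGreatest (hP _ hP1) hP1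
  omega

end Nets

/-! ### Factorization, nets and compactness for low-rank matrices. -/

section LowRank

variable {M : ℕ}

/-- The matrix of a continuous endomorphism of `ℝ^M`. -/
noncomputable def ofCLM (T : Vec M →L[ℝ] Vec M) : Mat M := (Matrix.toEuclideanCLM (𝕜 := ℝ)).symm T

@[simp] theorem act_ofCLM (T : Vec M →L[ℝ] Vec M) : act (ofCLM T) = T :=
  (Matrix.toEuclideanCLM (𝕜 := ℝ)).apply_symm_apply T

@[simp] theorem ofCLM_act (Q : Mat M) : ofCLM (act Q) = Q :=
  (Matrix.toEuclideanCLM (𝕜 := ℝ)).symm_apply_apply Q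

theorem rank_eq_finrank_range_act (Q : Mat M) :
    Q.rank = Module.finrank ℝ (LinearMap.range (act Q : Vec M →ₗ[ℝ] Vec M)) := by
  rw [act, Matrix.coe_toEuclideanCLM_eq_toEuclideanLin, Matrix.toEuclideanLin_eq_toLin_orthonormal]
  exact Matrix.rank_eq_finrank_range_toLin Q _ _

theorem ofCLM_comp_mem_lowRankSet {ρ : ℝ} {r : ℕ} {U : Vec r →L[ℝ] Vec M}
    {C : Vec M →L[ℝ] Vec r} (hU : ‖U‖ ≤ 1) (hC : ‖C‖ ≤ ρ) :
    ofCLM (U ∘L C) ∈ lowRankSet M ρ r := by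
  refine ⟨?_, ?_⟩
  · rw [rank_eq_finrank_range_act, act_ofCLM]
    have hle : LinearMap.range (U ∘L C : Vec M →ₗ[ℝ] Vec M) ≤
        LinearMap.range (U : Vec r →ₗ[ℝ] Vec M) := by
      rintro _ ⟨x, rfl⟩
      exact ⟨C x, rfl⟩
    refine (Submodule.finrank_mono hle).trans ?_
    refine (LinearMap.finrank_range_le _).trans ?_
    simp
  · rw [specNorm, act_ofCLM]
    refine (U.opNorm_comp_le C).trans ?_
    nlinarith [norm_nonneg C, norm_nonneg U]

/-- The range `W` has dimension at most `r`, so it embeds isometrically in `ℝ^r` by some `J`. Since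
`J* J = 1` on `W`, one takes `C = J Q` and `U` the inclusion of `W` composed with `J*`. -/
theorem exists_comp_of_mem_lowRankSet {ρ : ℝ} {r : ℕ} {Q : Mat M} (hQ : Q ∈ lowRankSet M ρ r) :
    ∃ (U : Vec r →L[ℝ] Vec M) (C : Vec M →L[ℝ] Vec r), ‖U‖ ≤ 1 ∧ ‖C‖ ≤ ρ ∧
      act Q = U ∘L C := by
  obtain ⟨hrank, hnorm⟩ := hQ
  rw [rank_eq_finrank_range_act] at hrank
  set W := LinearMap.range (act Q : Vec M →ₗ[ℝ] Vec M) with hW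
  let v := stdOrthonormalBasis ℝ W
  let e : Fin (Module.finrank ℝ W) → Vec r :=
    fun i => EuclideanSpace.basisFun (Fin r) ℝ (Fin.castLE hrank i)
  have he : Orthonormal ℝ e :=
    (EuclideanSpace.basisFun (Fin r) ℝ).orthonormal.comp _ (Fin.castLE_injective hrank)
  let f : W →ₗ[ℝ] Vec r := v.toBasis.constr ℝ e
  have hfv : f ∘ v.toBasis = e := funext fun i => v.toBasis.constr_basis ℝ e i
  let J : W →ₗᵢ[ℝ] Vec r := f.isometryOfOrthonormal (v := v.toBasis) (by simp)
    (by rw [hfv]; exact he)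
  let J' : W →L[ℝ] Vec r := J.toContinuousLinearMap
  have hJ'1 : ‖J'‖ ≤ 1 := J.norm_toContinuousLinearMap_le
  have hJJ : ∀ w, ContinuousLinearMap.adjoint J' (J' w) = w := fun w => by
    refine ext_inner_right ℝ fun w' => ?_
    rw [ContinuousLinearMap.adjoint_inner_left]
    exact J.inner_map_map w w'
  let T : Vec M →L[ℝ] W := (act Q).codRestrict W fun x => LinearMap.mem_range_self _ x
  have hT : ‖T‖ ≤ ρ := by
    refine ContinuousLinearMap.opNorm_le_bound _ ((norm_nonneg _).trans hnorm) fun x => ?_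
    exact ((act Q).le_opNorm x).trans (by gcongr; exact hnorm)
  refine ⟨W.subtypeL ∘L ContinuousLinearMap.adjoint J', J' ∘L T, ?_, ?_, ?_⟩
  · refine (ContinuousLinearMap.opNorm_comp_le _ _).trans ?_
    rw [LinearIsometryEquiv.norm_map]
    exact mul_le_one₀ W.norm_subtypeL_le (norm_nonneg J') hJ'1
  · refine (ContinuousLinearMap.opNorm_comp_le _ _).trans ?_
    nlinarith [norm_nonneg T, norm_nonneg J']
  · ext1 x
    simp only [ContinuousLinearMap.comp_apply, hJJ]
    rfl

theorem zero_mem_lowRankSet {ρ : ℝ} (hρ : 0 ≤ ρ) (r : ℕ) : (0 : Mat M) ∈ lowRankSet M ρ r := by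
  refine ⟨by simp, ?_⟩
  rw [specNorm, act, map_zero, norm_zero]
  exact hρ

theorem finiteDimensional_clm (k l : ℕ) : FiniteDimensional ℝ (Vec k →L[ℝ] Vec l) :=
  (LinearMap.toContinuousLinearMap (𝕜 := ℝ) (E := Vec k) (F' := Vec l)).finiteDimensional

theorem finrank_clm (k l : ℕ) : Module.finrank ℝ (Vec k →L[ℝ] Vec l) = k * l := by
  rw [← (LinearMap.toContinuousLinearMap (𝕜 := ℝ) (E := Vec k) (F' := Vec l)).finrank_eq,
    Module.finrank_linearMap]
  simp

theorem norm_comp_sub_comp_le {r : ℕ} (U U' : Vec r →L[ℝ] Vec M) (C C' : Vec M →L[ℝ] Vec r) :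
    ‖U ∘L C - U' ∘L C'‖ ≤ ‖U - U'‖ * ‖C‖ + ‖U'‖ * ‖C - C'‖ := by
  have : U ∘L C - U' ∘L C' = (U - U') ∘L C + U' ∘L (C - C') := by
    ext1 x; simp
  rw [this]
  exact (norm_add_le _ _).trans
    (add_le_add (ContinuousLinearMap.opNorm_comp_le _ _) (ContinuousLinearMap.opNorm_comp_le _ _))

/-- A `ρ / (2 n)`-net of the set of low-rank matrices with at most `(9 n) ^ (2 M r)` points. -/
theorem exists_net_lowRankSet {ρ : ℝ} (hρ : 0 < ρ) (r : ℕ) {n : ℕ} (hn : 1 ≤ n) :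
    ∃ s : Finset (Mat M), (∀ Q ∈ s, specNorm Q ≤ ρ) ∧
      (∀ Q ∈ lowRankSet M ρ r, ∃ Q' ∈ s, ‖act Q - act Q'‖ ≤ ρ / (2 * n)) ∧
      (s.card : ℝ) ≤ (9 * n) ^ (2 * (M * r)) := by
  classical
  have hn' : (1 : ℝ) ≤ n := by exact_mod_cast hn
  have hn0 : (0 : ℝ) < n := by linarith
  have := finiteDimensional_clm r M
  have := finiteDimensional_clm M r
  -- Each factor contributes `ρ / (4n)` to the error of the product. Both radii are `1 / (4n)`
  -- relative to the ball, so each net has at most `(1 + 8n)^(rM) ≤ (9n)^(rM)` points.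
  obtain ⟨s₁, h1, h1', h1c⟩ := exists_net_closedBall (V := Vec r →L[ℝ] Vec M) one_pos
    (show (0 : ℝ) < 1 / (4 * n) by positivity)
  obtain ⟨s₂, h2, h2', h2c⟩ := exists_net_closedBall (V := Vec M →L[ℝ] Vec r) hρ
    (show (0 : ℝ) < ρ / (4 * n) by positivity)
  rw [finrank_clm] at h1c h2c
  refine ⟨(s₁ ×ˢ s₂).image fun p => ofCLM (p.1 ∘L p.2), ?_, fun Q hQ => ?_, ?_⟩
  · intro Q hQ
    obtain ⟨p, hp, rfl⟩ := Finset.mem_image.1 hQ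
    rw [Finset.mem_product] at hp
    exact (ofCLM_comp_mem_lowRankSet (h1 _ hp.1) (h2 _ hp.2)).2
  · obtain ⟨U, C, hU, hC, hUC⟩ := exists_comp_of_mem_lowRankSet hQ
    obtain ⟨U', hU's, hU'⟩ := h1' U hU
    obtain ⟨C', hC's, hC'⟩ := h2' C hC
    refine ⟨ofCLM (U' ∘L C'), Finset.mem_image.2 ⟨(U', C'), Finset.mk_mem_product hU's hC's, rfl⟩, ?_⟩
    rw [hUC, act_ofCLM]
    refine (norm_comp_sub_comp_le U U' C C').trans ?_
    calc ‖U - U'‖ * ‖C‖ + ‖U'‖ * ‖C - C'‖ ≤ 1 / (4 * n) * ρ + 1 * (ρ / (4 * n)) := by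
          gcongr
          exact h1 U' hU's
      _ = ρ / (2 * n) := by field_simp; norm_num
  · have e1 : 1 + 2 * 1 / (1 / (4 * (n : ℝ))) ≤ 9 * n := by field_simp; linarith
    have e2 : 1 + 2 * ρ / (ρ / (4 * (n : ℝ))) ≤ 9 * n := by field_simp; linarith
    calc _ ≤ (((s₁ ×ˢ s₂).card : ℕ) : ℝ) := by exact_mod_cast Finset.card_image_le
      _ = s₁.card * s₂.card := by rw [Finset.card_product]; push_cast; ring
      _ ≤ (9 * n) ^ (r * M) * (9 * n) ^ (M * r) := by
          gcongr
          · exact h1c.trans (by gcongr)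
          · exact h2c.trans (by gcongr)
      _ = _ := by rw [← pow_add]; congr 1; ring

/-- A function of a matrix that is continuous in the operator norm has a minimizer over the
matrices of bounded rank and norm. -/
theorem exists_isMinOn_lowRankSet {ρ : ℝ} (hρ : 0 ≤ ρ) (r : ℕ) {F : Mat M → ℝ} {K : ℝ}
    (hF : ∀ Q Q', |F Q - F Q'| ≤ K * ‖act Q - act Q'‖) :
    ∃ Q ∈ lowRankSet M ρ r, IsMinOn F (lowRankSet M ρ r) Q := by
  have := finiteDimensional_clm r M
  have := finiteDimensional_clm M r
  have : ProperSpace (Vec r →L[ℝ] Vec M) := FiniteDimensional.proper ℝ _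
  have : ProperSpace (Vec M →L[ℝ] Vec r) := FiniteDimensional.proper ℝ _
  -- The class is the continuous image of this compact set of pairs of factors, so closedness of the
  -- rank condition need not be proved.
  let S : Set ((Vec r →L[ℝ] Vec M) × (Vec M →L[ℝ] Vec r)) :=
    Metric.closedBall 0 1 ×ˢ Metric.closedBall 0 ρ
  have hS : IsCompact S := (isCompact_closedBall _ _).prod (isCompact_closedBall _ _)
  have hne : S.Nonempty := ⟨(0, 0), by simp [S, hρ]⟩
  have hcF : Continuous fun T : Vec M →L[ℝ] Vec M => F (ofCLM T) :=
    continuous_of_abs_sub_le (K := K) fun T T' => by simpa using hF (ofCLM T) (ofCLM T')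
  have hcc : Continuous fun p : (Vec r →L[ℝ] Vec M) × (Vec M →L[ℝ] Vec r) => p.1 ∘L p.2 :=
    continuous_fst.clm_comp continuous_snd
  obtain ⟨p, hp, hmin⟩ := hS.exists_isMinOn hne (hcF.comp hcc).continuousOn
  have hp' : ‖p.1‖ ≤ 1 ∧ ‖p.2‖ ≤ ρ := by simpa [S] using hp
  refine ⟨ofCLM (p.1 ∘L p.2), ofCLM_comp_mem_lowRankSet hp'.1 hp'.2, fun Q hQ => ?_⟩
  obtain ⟨U, C, hU, hC, hUC⟩ := exists_comp_of_mem_lowRankSet hQ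
  have hUCS : (U, C) ∈ S := by simp [S, hU, hC]
  have := hmin hUCS
  simp only [Set.mem_ofPred_eq, Function.comp_apply, ← hUC, ofCLM_act] at this
  exact this

end LowRank

/-! ### Integrability of the stationary law. -/

section ChainMean

variable {Ω : Type*} {mΩ : MeasurableSpace Ω} {μ : Measure Ω} [IsProbabilityMeasure μ]
  {E : Type*} [NormedAddCommGroup E] [NormedSpace ℝ E] [MeasurableSpace E] [BorelSpace E]
  [SecondCountableTopology E] {A : E →L[ℝ] E} {ν : Measure E} [IsProbabilityMeasure ν]
  {𝓕 : Filtration ℕ mΩ} {Y ζ : ℕ → Ω → E} {ρ : ℝ}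

/-- `Z` is the sum of the innovation norms with geometric weights; the bound on its mean does not
depend on `k`. -/
theorem IsARChain.exists_norm_le (h : IsARChain μ A ν 𝓕 Y ζ) (hA : ‖A‖ ≤ ρ) (hρ : ρ < 1)
    (hν : Integrable (fun x => ‖x‖) ν) (k : ℕ) :
    ∃ Z : Ω → ℝ, Measurable Z ∧ (∀ ω, 0 ≤ Z ω) ∧
      (∀ ω, ‖Y k ω‖ ≤ ρ ^ k * ‖Y 0 ω‖ + Z ω) ∧
      ∫⁻ ω, ENNReal.ofReal (Z ω) ∂μ ≤ ENNReal.ofReal ((∫ x, ‖x‖ ∂ν) / (1 - ρ)) := by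
  have hρ0 : 0 ≤ ρ := (norm_nonneg A).trans hA
  have h1ρ : 0 < 1 - ρ := by linarith
  have hm : 0 ≤ ∫ x, ‖x‖ ∂ν := integral_nonneg fun x => norm_nonneg x
  induction k with
  | zero => exact ⟨fun _ => 0, measurable_const, fun _ => le_rfl, fun ω => by simp, by simp⟩
  | succ k ih =>
    obtain ⟨Z, hZm, hZ0, hZ, hZi⟩ := ih
    refine ⟨fun ω => ρ * Z ω + ‖ζ k ω‖, (hZm.const_mul ρ).add (h.measurable_noise' k).norm,
      fun ω => add_nonneg (mul_nonneg hρ0 (hZ0 ω)) (norm_nonneg _), fun ω => ?_, ?_⟩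
    · rw [h.step]
      calc ‖A (Y k ω) + ζ k ω‖ ≤ ρ * ‖Y k ω‖ + ‖ζ k ω‖ :=
            (norm_add_le _ _).trans (add_le_add_left
              ((A.le_opNorm _).trans (by gcongr)) _)
        _ ≤ ρ * (ρ ^ k * ‖Y 0 ω‖ + Z ω) + ‖ζ k ω‖ := by gcongr; exact hZ ω
        _ = _ := by ring
    · have hζ : ∫⁻ ω, ENNReal.ofReal ‖ζ k ω‖ ∂μ = ENNReal.ofReal (∫ x, ‖x‖ ∂ν) := by
        rw [ofReal_integral_eq_lintegral_ofReal hν (.of_forall fun x => norm_nonneg x), ← h.law k,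
          lintegral_map (by fun_prop) (h.measurable_noise' k)]
      calc ∫⁻ ω, ENNReal.ofReal (ρ * Z ω + ‖ζ k ω‖) ∂μ
          = ∫⁻ ω, (ENNReal.ofReal ρ * ENNReal.ofReal (Z ω) + ENNReal.ofReal ‖ζ k ω‖) ∂μ := by
            refine lintegral_congr fun ω => ?_
            rw [ENNReal.ofReal_add (mul_nonneg hρ0 (hZ0 ω)) (norm_nonneg _),
              ENNReal.ofReal_mul hρ0]
        _ = ENNReal.ofReal ρ * ∫⁻ ω, ENNReal.ofReal (Z ω) ∂μ +
              ∫⁻ ω, ENNReal.ofReal ‖ζ k ω‖ ∂μ := by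
            rw [lintegral_add_left (by fun_prop), lintegral_const_mul _ (by fun_prop)]
        _ ≤ ENNReal.ofReal ρ * ENNReal.ofReal ((∫ x, ‖x‖ ∂ν) / (1 - ρ)) +
              ENNReal.ofReal (∫ x, ‖x‖ ∂ν) := by
            rw [hζ]
            gcongr
        _ = _ := by
            rw [← ENNReal.ofReal_mul hρ0, ← ENNReal.ofReal_add (by positivity) hm]
            congr 1
            field_simp
            ring

/-- The marginals of a stationary chain are integrable, without any prior moment assumption. -/
theorem IsARChain.integrable_norm_init (h : IsARChain μ A ν 𝓕 Y ζ) (hA : ‖A‖ ≤ ρ) (hρ : ρ < 1)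
    (hν : Integrable (fun x => ‖x‖) ν)
    (hstat : ∀ k : ℕ, IdentDistrib (fun ω (t : ℕ) => Y (t + k) ω) (fun ω (t : ℕ) => Y t ω) μ μ) :
    Integrable (fun ω => ‖Y 0 ω‖) μ ∧ ∫ ω, ‖Y 0 ω‖ ∂μ ≤ (∫ x, ‖x‖ ∂ν) / (1 - ρ) := by
  have hρ0 : 0 ≤ ρ := (norm_nonneg A).trans hA
  have h1ρ : 0 < 1 - ρ := by linarith
  have hm : 0 ≤ ∫ x, ‖x‖ ∂ν := integral_nonneg fun x => norm_nonneg x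
  have hYm := h.measurable 0
  set c := ENNReal.ofReal ((∫ x, ‖x‖ ∂ν) / (1 - ρ)) with hc
  -- Truncation makes the expectation finite before anything is known about `Y 0`. By stationarity
  -- `Y 0` may be replaced by `Y k`, and the contribution of the initial state vanishes as `k → ∞`
  -- by dominated convergence.
  have htrunc : ∀ K : ℕ, ∫⁻ ω, ENNReal.ofReal (min ‖Y 0 ω‖ K) ∂μ ≤ c := fun K => by
    have hk : ∀ k : ℕ, ∫⁻ ω, ENNReal.ofReal (min ‖Y 0 ω‖ K) ∂μ ≤
        ∫⁻ ω, ENNReal.ofReal (min (ρ ^ k * ‖Y 0 ω‖) K) ∂μ + c := fun k => by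
      obtain ⟨Z, hZm, hZ0, hZ, hZi⟩ := h.exists_norm_le hA hρ hν k
      have hid : ∫⁻ ω, ENNReal.ofReal (min ‖Y 0 ω‖ K) ∂μ =
          ∫⁻ ω, ENNReal.ofReal (min ‖Y k ω‖ K) ∂μ := by
        have hu : Measurable fun y : ℕ → E => ENNReal.ofReal (min ‖y 0‖ K) := by
          have := measurable_pi_apply (X := fun _ : ℕ => E) 0
          fun_prop
        have := ((hstat k).comp hu).lintegral_eq
        simpa [Function.comp_def] using this.symm
      rw [hid]
      calc _ ≤ ∫⁻ ω, (ENNReal.ofReal (min (ρ ^ k * ‖Y 0 ω‖) K) + ENNReal.ofReal (Z ω)) ∂μ := by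
            refine lintegral_mono fun ω => ?_
            rw [← ENNReal.ofReal_add (by positivity) (hZ0 ω)]
            refine ENNReal.ofReal_le_ofReal ?_
            rw [min_add]
            refine le_min ((min_le_left _ _).trans (hZ ω)) ((min_le_right _ _).trans ?_)
            linarith [hZ0 ω]
        _ ≤ _ := by
            rw [lintegral_add_left (by fun_prop)]
            gcongr
    have hlim : Filter.Tendsto
        (fun k : ℕ => ∫⁻ ω, ENNReal.ofReal (min (ρ ^ k * ‖Y 0 ω‖) K) ∂μ) Filter.atTop
        (nhds (∫⁻ _ω, 0 ∂μ)) := by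
      refine tendsto_lintegral_of_dominated_convergence (fun _ => ENNReal.ofReal K)
        (fun k => by fun_prop) (fun k => .of_forall fun ω => ?_) (by simp) (.of_forall fun ω => ?_)
      · exact ENNReal.ofReal_le_ofReal (min_le_right _ _)
      · have h1 : Filter.Tendsto (fun k : ℕ => min (ρ ^ k * ‖Y 0 ω‖) K) Filter.atTop
            (nhds (min (0 * ‖Y 0 ω‖) K)) :=
          ((tendsto_pow_atTop_nhds_zero_of_lt_one hρ0 hρ).mul_const _).min tendsto_const_nhds
        have h2 := (ENNReal.continuous_ofReal.tendsto _).comp h1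
        simpa [Function.comp_def] using h2
    refine ge_of_tendsto' (x := Filter.atTop) ?_ hk
    simpa using hlim.add_const c
  have hfull : ∫⁻ ω, ENNReal.ofReal ‖Y 0 ω‖ ∂μ ≤ c := by
    have hmono := lintegral_tendsto_of_tendsto_of_monotone (μ := μ)
      (f := fun K ω => ENNReal.ofReal (min ‖Y 0 ω‖ (K : ℕ)))
      (F := fun ω => ENNReal.ofReal ‖Y 0 ω‖) (fun K => by fun_prop)
      (.of_forall fun ω K K' hK => by
        have : (K : ℝ) ≤ K' := by exact_mod_cast hK
        simp only
        gcongr)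
      (.of_forall fun ω => by
        obtain ⟨K₀, hK₀⟩ := exists_nat_ge ‖Y 0 ω‖
        refine tendsto_const_nhds.congr' ?_
        filter_upwards [Filter.eventually_ge_atTop K₀] with K hK
        rw [min_eq_left (hK₀.trans (by exact_mod_cast hK))])
    exact le_of_tendsto' hmono htrunc
  have hint : Integrable (fun ω => ‖Y 0 ω‖) μ := by
    refine ⟨hYm.norm.aestronglyMeasurable, ?_⟩
    rw [hasFiniteIntegral_iff_ofReal (.of_forall fun ω => norm_nonneg _)]
    exact hfull.trans_lt ENNReal.ofReal_lt_top
  refine ⟨hint, ?_⟩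
  rw [← ofReal_integral_eq_lintegral_ofReal hint (.of_forall fun ω => norm_nonneg _), hc] at hfull
  exact (ENNReal.ofReal_le_ofReal_iff (by positivity)).1 hfull

end ChainMean

/-! ### The stationary VAR process as such a chain. -/

section VAR

variable {Ω : Type*} [MeasurableSpace Ω] {μ : Measure Ω} [IsProbabilityMeasure μ] {M : ℕ}
  {A : Mat M} {ξ X : ℕ → Ω → Vec M}

/-- The initial value followed by the noise. -/
def drivers (ξ X : ℕ → Ω → Vec M) (k : ℕ) : Ω → Vec M :=
  if k = 0 then X 1 else ξ (k + 1)

theorem IsStationaryVAR.measurable_drivers (hX : IsStationaryVAR μ A ξ X) (k : ℕ) :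
    Measurable (drivers ξ X k) := by
  unfold drivers
  split_ifs with h
  · exact hX.measurable_init
  · exact hX.measurable_noise _ (by omega)

/-- A finite family of events is padded with `univ` to an initial segment `0, …, N`. The event on `X
1` then separates by `indep_init`, and the others by `indep_noise`. -/
theorem IsStationaryVAR.iIndepFun_drivers (hX : IsStationaryVAR μ A ξ X) :
    iIndepFun (drivers ξ X) μ := by
  classical
  rw [iIndepFun_iff_measure_inter_preimage_eq_mul]
  intro S sets hsets
  obtain ⟨N, hN⟩ : ∃ N, S ⊆ Finset.range (N + 1) :=
    ⟨S.sup id, fun i hi => Finset.mem_range.2 (Nat.lt_succ_of_le (Finset.le_sup (f := id) hi))⟩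
  set sets' : ℕ → Set (Vec M) := fun i => if i ∈ S then sets i else Set.univ with hsets'
  have hm : ∀ i, MeasurableSet (sets' i) := fun i => by
    simp only [hsets']
    split_ifs with h
    exacts [hsets i h, MeasurableSet.univ]
  have hprod : ∏ i ∈ S, μ (drivers ξ X i ⁻¹' sets i) =
      ∏ i ∈ Finset.range (N + 1), μ (drivers ξ X i ⁻¹' sets' i) := by
    rw [← Finset.prod_subset hN fun i _ hi => by simp [hsets', hi]]
    exact Finset.prod_congr rfl fun i hi => by simp [hsets', hi]
  have hinter : ⋂ i ∈ S, drivers ξ X i ⁻¹' sets i = X 1 ⁻¹' sets' 0 ∩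
      (fun ω (t : ℕ) => ξ (t + 2) ω) ⁻¹' {y | ∀ t ∈ Finset.range N, y t ∈ sets' (t + 1)} := by
    ext ω
    simp only [Set.mem_iInter, Set.mem_preimage, Set.mem_inter_iff, Set.mem_ofPred_eq]
    constructor
    · intro hω
      have hω' : ∀ i, drivers ξ X i ω ∈ sets' i := fun i => by
        by_cases hi : i ∈ S
        · simpa [hsets', hi] using hω i hi
        · simp [hsets', hi]
      exact ⟨by simpa [drivers] using hω' 0, fun t _ => by simpa [drivers] using hω' (t + 1)⟩
    · rintro ⟨h0, h1⟩ i hi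
      rcases i with _ | t
      · simpa [hsets', hi, drivers] using h0
      · have := h1 t (by have := Finset.mem_range.1 (hN hi); exact Finset.mem_range.2 (by omega))
        simpa [hsets', hi, drivers] using this
  have hpast : MeasurableSet {y : ℕ → Vec M | ∀ t ∈ Finset.range N, y t ∈ sets' (t + 1)} := by
    have : {y : ℕ → Vec M | ∀ t ∈ Finset.range N, y t ∈ sets' (t + 1)} =
        ⋂ t ∈ Finset.range N, (fun y : ℕ → Vec M => y t) ⁻¹' sets' (t + 1) := by
      ext y; simp
    rw [this]
    exact Finset.measurableSet_biInter _ fun t _ => measurable_pi_apply t (hm (t + 1))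
  rw [hprod, hinter, hX.indep_init.measure_inter_preimage_eq_mul _ _ (hm 0) hpast,
    Finset.prod_range_succ', mul_comm]
  congr 1
  have := hX.indep_noise.measure_inter_preimage_eq_mul (Finset.range N)
    (sets := fun t => sets' (t + 1)) fun t _ => hm (t + 1)
  simp only [drivers, Nat.add_eq_zero_iff, one_ne_zero, and_false, if_false]
  rw [← this]
  congr 1
  ext ω
  simp

/-- Time is shifted by one: chain time `0` is `X 1`, and the innovation entering at step `k` is `ξ
(k + 2)`, that is, driver `k + 1`. -/
theorem IsStationaryVAR.isARChain (hX : IsStationaryVAR μ A ξ X) :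
    IsARChain μ (act A) (μ.map (ξ 2))
      (Filtration.natural (drivers ξ X) fun k => (hX.measurable_drivers k).stronglyMeasurable)
      (fun k => X (k + 1)) (fun k => ξ (k + 2)) where
  measurable_init :=
    (Filtration.stronglyAdapted_natural
      (fun k => (hX.measurable_drivers k).stronglyMeasurable) 0).measurable
  measurable_noise k :=
    (Filtration.stronglyAdapted_natural
      (fun k => (hX.measurable_drivers k).stronglyMeasurable) (k + 1)).measurable
  indep k := hX.iIndepFun_drivers.indep_comap_natural_of_lt _ k.lt_succ_self
  law k := (hX.ident_noise (k + 2) (by omega)).map_eq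
  step k ω := hX.recursion (k + 2) (by omega) ω

/-- The scale `√M * c` turns the squared norm into an average of squared coordinates, so the
coordinatewise bound `d` passes to the norm without loss. -/
theorem IsStationaryVAR.integrable_cosh (hX : IsStationaryVAR μ A ξ X) (hM : 1 ≤ M) {c d : ℝ}
    (hξ : HasExpMoment μ c d (ξ 2)) (hc : 0 < c) (hd : 0 < d) :
    Integrable (fun x => Real.cosh (‖x‖ / (√M * c))) (μ.map (ξ 2)) ∧
      ∫ x, Real.cosh (‖x‖ / (√M * c)) ∂(μ.map (ξ 2)) ≤ d := by
  have hm := hX.measurable_noise 2 le_rfl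
  have hmj : ∀ j, Measurable fun ω => ξ 2 ω j := fun j =>
    (EuclideanSpace.proj (𝕜 := ℝ) j).continuous.measurable.comp hm
  have hexp : ∀ j, Integrable (fun ω => Real.exp (|ξ 2 ω j| / c)) μ ∧
      ∫ ω, Real.exp (|ξ 2 ω j| / c) ∂μ ≤ d := fun j => by
    have hi : Integrable (fun ω => Real.exp (|ξ 2 ω j| / c)) μ := by
      refine ⟨(((hmj j).abs.div_const c).exp).aestronglyMeasurable, ?_⟩
      rw [hasFiniteIntegral_iff_ofReal (.of_forall fun ω => (Real.exp_pos _).le)]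
      exact (hξ j).trans_lt ENNReal.ofReal_lt_top
    refine ⟨hi, ?_⟩
    have := hξ j
    rw [← ofReal_integral_eq_lintegral_ofReal hi (.of_forall fun ω => (Real.exp_pos _).le)] at this
    exact (ENNReal.ofReal_le_ofReal_iff hd.le).1 this
  have hle : ∀ ω, Real.cosh (‖ξ 2 ω‖ / (√M * c)) ≤
      ∑ j, (M : ℝ)⁻¹ * Real.exp (|ξ 2 ω j| / c) := fun ω => by
    refine (cosh_norm_le_mean hM _).trans ?_
    gcongr with j _
    rw [Real.cosh_eq]
    have : Real.exp (-(|ξ 2 ω j| / c)) ≤ Real.exp (|ξ 2 ω j| / c) := by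
      have : 0 ≤ |ξ 2 ω j| / c := by positivity
      gcongr
      linarith
    linarith
  have hsum : Integrable (fun ω => ∑ j, (M : ℝ)⁻¹ * Real.exp (|ξ 2 ω j| / c)) μ :=
    integrable_finsetSum _ fun j _ => (hexp j).1.const_mul _
  have hcm : Measurable fun x : Vec M => Real.cosh (‖x‖ / (√M * c)) :=
    (Real.continuous_cosh.comp (continuous_norm.div_const _)).measurable
  have hint : Integrable (fun ω => Real.cosh (‖ξ 2 ω‖ / (√M * c))) μ :=
    hsum.mono' (hcm.comp hm).aestronglyMeasurable (.of_forall fun ω => by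
      rw [Real.norm_eq_abs, abs_of_pos (Real.cosh_pos _)]; exact hle ω)
  refine ⟨(integrable_map_measure hcm.aestronglyMeasurable hm.aemeasurable).2 hint, ?_⟩
  rw [integral_map hm.aemeasurable hcm.aestronglyMeasurable]
  calc _ ≤ ∫ ω, ∑ j, (M : ℝ)⁻¹ * Real.exp (|ξ 2 ω j| / c) ∂μ := integral_mono hint hsum hle
    _ = ∑ j, (M : ℝ)⁻¹ * ∫ ω, Real.exp (|ξ 2 ω j| / c) ∂μ := by
        rw [integral_finsetSum _ fun j _ => (hexp j).1.const_mul _]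
        simp only [integral_const_mul]
    _ ≤ ∑ _j : Fin M, (M : ℝ)⁻¹ * d := by
        gcongr with j _
        exact (hexp j).2
    _ = d := by
        have : (M : ℝ) ≠ 0 := by positivity
        simp [this]

end VAR

/-! ### Numerical constants. -/

theorem V₀_pos {ρ c d : ℝ} (hρ : ρ < 1) (hc : 0 < c) (hd : 0 < d) : 0 < V₀ ρ c d := by
  have h1 : 0 < 1 - ρ := by linarith
  have h2 : 0 < 2 - ρ := by linarith
  unfold V₀
  positivity

theorem δ₀_pos {ρ c : ℝ} (hρ : ρ < 1) (hc : 0 < c) : 0 < δ₀ ρ c := by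
  have h1 : 0 < 1 - ρ := by linarith
  unfold δ₀
  positivity

/-- The variance proxy of a sum of `N ≥ 1` steps of a stationary chain, past included. -/
theorem variance_proxy_le {ρ c d : ℝ} (hρ₀ : 0 < ρ) (hρ : ρ < 1) (hd : 0 < d) {w N : ℝ}
    (hN : 1 ≤ N) (hw : 0 ≤ w) :
    w * δ₀ ρ c ^ 2 * d * (N + 1 / (1 - ρ)) ≤ w * V₀ ρ c d / 4 * N := by
  have h1 : 0 < 1 - ρ := by linarith
  have h2 : 0 < 2 - ρ := by linarith
  have he := Real.add_one_le_exp (1 : ℝ)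
  have hN' : N + 1 / (1 - ρ) ≤ N * ((2 - ρ) / (1 - ρ)) := by
    have : N * ((2 - ρ) / (1 - ρ)) = N + N * (1 / (1 - ρ)) := by field_simp; ring
    rw [this]
    have : 0 ≤ 1 / (1 - ρ) := by positivity
    nlinarith
  calc w * δ₀ ρ c ^ 2 * d * (N + 1 / (1 - ρ))
      ≤ w * δ₀ ρ c ^ 2 * d * (N * ((2 - ρ) / (1 - ρ))) := by gcongr
    _ = 2 * (w * 2 * c ^ 2 * d * (2 - ρ) / (1 - ρ) ^ 3 * N) := by
        unfold δ₀; field_simp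
    -- Here `2 ≤ e`, from `exp 1 ≥ 1 + 1`.
    _ ≤ Real.exp 1 * (w * 2 * c ^ 2 * d * (2 - ρ) / (1 - ρ) ^ 3 * N) := by
        gcongr
        linarith
    _ = _ := by unfold V₀; field_simp; ring

/-- Allows the mean norm of `X 1` to be absorbed into the `V₀ / δ₀` terms. -/
theorem mean_norm_const_le {ρ c d : ℝ} (hρ₀ : 0 < ρ) (hρ : ρ < 1) (hc : 0 < c) (hd : 0 < d) :
    c * d / (1 - ρ) ≤ V₀ ρ c d / (8 * δ₀ ρ c) := by
  have h1 : 0 < 1 - ρ := by linarith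
  have h2 : 0 < 2 - ρ := by linarith
  have he := Real.add_one_le_exp (1 : ℝ)
  have e1 : V₀ ρ c d / (8 * δ₀ ρ c) = (c * d / (1 - ρ)) * (Real.exp 1 / 2 * ((2 - ρ) / (1 - ρ))) := by
    unfold V₀ δ₀; field_simp
  rw [e1]
  refine le_mul_of_one_le_right (by positivity) ?_
  have : 1 ≤ (2 - ρ) / (1 - ρ) := by rw [le_div_iff₀ h1]; linarith
  nlinarith

/-- The average of the norms of the predictors. -/
noncomputable def meanNorm {M : ℕ} (n : ℕ) (x : ℕ → Vec M) : ℝ :=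
  1 / ((n : ℝ) - 1) * ∑ i ∈ Finset.Icc 2 n, ‖x (i - 1)‖

/-! ### Lipschitz dependence of the loss and the empirical risk. -/

section Lipschitz

variable {M : ℕ} {ℓ : Vec M → ℝ}

theorem abs_loss_sub_le (hℓ : LipschitzWith 1 ℓ) (Q : Mat M) {ρ : ℝ} (hQ : specNorm Q ≤ ρ)
    (x y x' y' : Vec M) :
    |ℓ (x - act Q y) - ℓ (x' - act Q y')| ≤ 1 * ‖x - x'‖ + ρ * ‖y - y'‖ := by
  have h := hℓ.dist_le_mul (x - act Q y) (x' - act Q y')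
  rw [Real.dist_eq, dist_eq_norm, NNReal.coe_one, one_mul] at h
  refine h.trans ?_
  have : x - act Q y - (x' - act Q y') = (x - x') - act Q (y - y') := by
    rw [map_sub]; abel
  rw [this, one_mul]
  refine (norm_sub_le _ _).trans ?_
  gcongr
  exact ((act Q).le_opNorm _).trans (by gcongr; exact hQ)

theorem abs_loss_sub_le' (hℓ : LipschitzWith 1 ℓ) (Q Q' : Mat M) (x y : Vec M) :
    |ℓ (x - act Q y) - ℓ (x - act Q' y)| ≤ ‖act Q - act Q'‖ * ‖y‖ := by
  have h := hℓ.dist_le_mul (x - act Q y) (x - act Q' y)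
  rw [Real.dist_eq, dist_eq_norm, NNReal.coe_one, one_mul, sub_sub_sub_cancel_left,
    ← sub_apply] at h
  rw [norm_sub_rev (act Q)]
  exact h.trans ((act Q' - act Q).le_opNorm y)

theorem abs_empRisk_sub_le (hℓ : LipschitzWith 1 ℓ) {n : ℕ} (hn : 2 ≤ n) (x : ℕ → Vec M)
    (Q Q' : Mat M) :
    |empRisk ℓ n x Q - empRisk ℓ n x Q'| ≤ ‖act Q - act Q'‖ * meanNorm n x := by
  have hg : (0 : ℝ) < n - 1 := by
    have : (2 : ℝ) ≤ n := by exact_mod_cast hn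
    linarith
  rw [empRisk, empRisk, meanNorm, ← mul_sub, abs_mul, abs_of_pos (by positivity),
    ← Finset.sum_sub_distrib, mul_left_comm]
  gcongr
  rw [Finset.mul_sum]
  exact (Finset.abs_sum_le_sum_abs _ _).trans
    (Finset.sum_le_sum fun i _ => abs_loss_sub_le' hℓ Q Q' _ _)

end Lipschitz

/-! ### Deviation inequalities for the empirical risk and the predictor norms. -/

section Deviation

variable {Ω : Type*} [MeasurableSpace Ω] {μ : Measure Ω} [IsProbabilityMeasure μ] {M n : ℕ}
  {A : Mat M} {ξ X : ℕ → Ω → Vec M} {ρ c d : ℝ}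

theorem IsStationaryVAR.measurable (hX : IsStationaryVAR μ A ξ X) (t : ℕ) (ht : 1 ≤ t) :
    Measurable (X t) := by
  have := Measure.isProbabilityMeasure_map (μ := μ) (hX.measurable_noise 2 le_rfl).aemeasurable
  obtain ⟨k, rfl⟩ : ∃ k, t = k + 1 := ⟨t - 1, by omega⟩
  exact hX.isARChain.measurable k

theorem IsStationaryVAR.integrable_norm_init (hX : IsStationaryVAR μ A ξ X) (hM : 1 ≤ M)
    (hρ₁ : ρ < 1) (hA : specNorm A ≤ ρ) (hc : 0 < c) (hd : 0 < d)
    (hξ : HasExpMoment μ c d (ξ 2)) :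
    Integrable (fun ω => ‖X 1 ω‖) μ ∧ ∫ ω, ‖X 1 ω‖ ∂μ ≤ √M * (c * d / (1 - ρ)) := by
  have := Measure.isProbabilityMeasure_map (μ := μ) (hX.measurable_noise 2 le_rfl).aemeasurable
  have h1 : 0 < 1 - ρ := by linarith
  have hM' : (0 : ℝ) < M := by exact_mod_cast hM
  have hτ : 0 < √M * c := by positivity
  obtain ⟨hν, hD⟩ := hX.integrable_cosh hM hξ hc hd
  obtain ⟨hi, hle⟩ := hX.isARChain.integrable_norm_init hA hρ₁ (integrable_norm_of_cosh hτ hν)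
    (fun k => by simpa only [add_right_comm] using hX.stationary k)
  refine ⟨hi, hle.trans ?_⟩
  rw [← mul_div_assoc, ← mul_assoc]
  gcongr
  exact integral_norm_le_of_cosh hτ hν hD

/-- Exponential deviation inequality for empirical means of a Lipschitz function of two
consecutive values of a stationary VAR process. -/
theorem IsStationaryVAR.measure_mean_ge_le (hX : IsStationaryVAR μ A ξ X) (hM : 1 ≤ M)
    (hn : 2 ≤ n) (hρ₀ : 0 < ρ) (hρ₁ : ρ < 1) (hA : specNorm A ≤ ρ) (hc : 0 < c) (hd : 0 < d)
    (hξ : HasExpMoment μ c d (ξ 2)) {f : Vec M → Vec M → ℝ} {a b s : ℝ}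
    (hf : ∀ x y x' y', |f x y - f x' y'| ≤ a * ‖x - x'‖ + b * ‖y - y'‖) (ha : 0 ≤ a)
    (hb : 0 ≤ b) (hs : 0 < s) (hs₁ : s * (a + b) * √M * δ₀ ρ c ≤ 1) (t : ℝ) :
    μ {ω | ∫ ω, f (X 2 ω) (X 1 ω) ∂μ + s * (a + b) ^ 2 * M * V₀ ρ c d / 4 +
        t / (s * ((n : ℝ) - 1)) ≤
        1 / ((n : ℝ) - 1) * ∑ i ∈ Finset.Icc 2 n, f (X i ω) (X (i - 1) ω)} ≤
      ENNReal.ofReal (Real.exp (-t)) := by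
  have := Measure.isProbabilityMeasure_map (μ := μ) (hX.measurable_noise 2 le_rfl).aemeasurable
  have h1 : 0 < 1 - ρ := by linarith
  have hM' : (0 : ℝ) < M := by exact_mod_cast hM
  have hτ : 0 < √M * c := by positivity
  obtain ⟨hν, hD⟩ := hX.integrable_cosh hM hξ hc hd
  obtain ⟨hi, -⟩ := hX.integrable_norm_init hM hρ₁ hA hc hd hξ
  have hg : (1 : ℝ) ≤ n - 1 := by
    have : (2 : ℝ) ≤ n := by exact_mod_cast hn
    linarith
  have hg0 : (0 : ℝ) < n - 1 := by linarith
  have hN : ((n - 1 : ℕ) : ℝ) = n - 1 := by rw [Nat.cast_sub (by omega)]; simp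
  -- With `τ = √M * c`, this `u` equals `2 * ((s * a + s * b) / (1 - ρ)) * τ` exactly. The threshold
  -- is `t` plus the bound of `variance_proxy_le`, which leaves probability `exp (-t)`.
  have hdev := hX.isARChain.measure_sum_ge_le hA hρ₁ hτ hν hD hi
    (fun k => by simpa only [add_right_comm] using hX.stationary k)
    (f := fun x y => s * f x y) (a := s * a) (b := s * b) (u := s * (a + b) * √M * δ₀ ρ c)
    (fun x y x' y' => by
      rw [← mul_sub, abs_mul, abs_of_pos hs, mul_assoc, mul_assoc, ← mul_add]
      exact mul_le_mul_of_nonneg_left (hf x y x' y') hs.le)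
    (by positivity) (by positivity) (le_of_eq (by unfold δ₀; field_simp)) hs₁ (n - 1)
    (t + (s * (a + b)) ^ 2 * M * V₀ ρ c d / 4 * ((n : ℝ) - 1))
  refine le_trans (measure_mono fun ω hω => ?_) (hdev.trans ?_)
  · have hω' := mul_le_mul_of_nonneg_left (Set.mem_ofPred_eq ▸ hω : _ ≤ _) (mul_pos hs hg0).le
    have hsum : ∑ i ∈ Finset.Icc 2 n, f (X i ω) (X (i - 1) ω) =
        ∑ j ∈ Finset.range (n - 1), f (X (j + 1 + 1) ω) (X (j + 1) ω) := by
      rw [← Finset.Ico_add_one_right_eq_Icc, Finset.sum_Ico_eq_sum_range]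
      refine Finset.sum_congr (by congr 1) fun j _ => ?_
      rw [show 2 + j = j + 1 + 1 by omega, Nat.add_sub_cancel]
    rw [hsum] at hω'
    simp only [Set.mem_ofPred_eq, hN, integral_const_mul, ← Finset.mul_sum]
    have e1 : s * ((n : ℝ) - 1) * (1 / ((n : ℝ) - 1) *
        ∑ j ∈ Finset.range (n - 1), f (X (j + 1 + 1) ω) (X (j + 1) ω)) =
        s * ∑ j ∈ Finset.range (n - 1), f (X (j + 1 + 1) ω) (X (j + 1) ω) := by
      field_simp
    rw [e1] at hω'
    refine le_trans (le_of_eq ?_) hω'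
    field_simp
    ring
  · refine ENNReal.ofReal_le_ofReal (Real.exp_le_exp.2 ?_)
    have hv := variance_proxy_le (c := c) hρ₀ hρ₁ hd hg
      (show 0 ≤ (s * (a + b)) ^ 2 * M by positivity)
    have e2 : (s * (a + b) * √M * δ₀ ρ c) ^ 2 = (s * (a + b)) ^ 2 * M * δ₀ ρ c ^ 2 := by
      rw [mul_pow, mul_pow _ (√M), Real.sq_sqrt hM'.le]
    rw [hN, e2]
    linarith

variable {ℓ : Vec M → ℝ}

theorem IsStationaryVAR.integrable_loss (hX : IsStationaryVAR μ A ξ X) (hM : 1 ≤ M)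
    (hρ₁ : ρ < 1) (hA : specNorm A ≤ ρ) (hc : 0 < c) (hd : 0 < d)
    (hξ : HasExpMoment μ c d (ξ 2)) (hℓ : LipschitzWith 1 ℓ) (Q : Mat M) :
    Integrable (fun ω => ℓ (X 2 ω - act Q (X 1 ω))) μ := by
  have := Measure.isProbabilityMeasure_map (μ := μ) (hX.measurable_noise 2 le_rfl).aemeasurable
  have hM' : (0 : ℝ) < M := by exact_mod_cast hM
  have hτ : 0 < √M * c := by positivity
  exact hX.isARChain.integrable_comp
    (integrable_norm_of_cosh hτ (hX.integrable_cosh hM hξ hc hd).1)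
    (hX.integrable_norm_init hM hρ₁ hA hc hd hξ).1 (f := fun x y => ℓ (x - act Q y))
    (abs_loss_sub_le hℓ Q le_rfl) zero_le_one (norm_nonneg _) 1 0

theorem abs_risk_sub_le (hℓ : LipschitzWith 1 ℓ) (hi : Integrable (fun ω => ‖X 1 ω‖) μ)
    (hint : ∀ Q : Mat M, Integrable (fun ω => ℓ (X 2 ω - act Q (X 1 ω))) μ) (Q Q' : Mat M) :
    |risk μ ℓ X Q - risk μ ℓ X Q'| ≤ ‖act Q - act Q'‖ * ∫ ω, ‖X 1 ω‖ ∂μ := by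
  rw [risk, risk, ← integral_sub (hint Q) (hint Q'), ← integral_const_mul]
  exact (abs_integral_le_integral_abs).trans (integral_mono ((hint Q).sub (hint Q')).abs
    (hi.const_mul _) fun ω => abs_loss_sub_le' hℓ Q Q' _ _)

theorem IsStationaryVAR.measurable_empRisk (hX : IsStationaryVAR μ A ξ X)
    (hℓ : LipschitzWith 1 ℓ) (Q : Mat M) : Measurable fun ω => empRisk ℓ n (fun t => X t ω) Q := by
  refine (Finset.measurable_fun_sum _ fun i hi => ?_).const_mul _
  have hi' := Finset.mem_Icc.1 hi
  exact hℓ.continuous.measurable.comp ((hX.measurable i (by omega)).sub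
    ((act Q).continuous.measurable.comp (hX.measurable (i - 1) (by omega))))

theorem IsStationaryVAR.measurable_meanNorm (hX : IsStationaryVAR μ A ξ X) :
    Measurable fun ω => meanNorm n (fun t => X t ω) := by
  refine (Finset.measurable_fun_sum _ fun i hi => ?_).const_mul _
  have hi' := Finset.mem_Icc.1 hi
  exact (hX.measurable (i - 1) (by omega)).norm

/-- Lower deviations of the empirical risk. -/
theorem IsStationaryVAR.measure_empRisk_add_le (hX : IsStationaryVAR μ A ξ X) (hM : 1 ≤ M)
    (hn : 2 ≤ n) (hρ₀ : 0 < ρ) (hρ₁ : ρ < 1) (hA : specNorm A ≤ ρ) (hc : 0 < c) (hd : 0 < d)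
    (hξ : HasExpMoment μ c d (ξ 2)) (hℓ : LipschitzWith 1 ℓ) {Q : Mat M} (hQ : specNorm Q ≤ ρ)
    {s : ℝ} (hs : 0 < s) (hs₁ : s * (1 + ρ) * √M * δ₀ ρ c ≤ 1) (t : ℝ) :
    μ {ω | empRisk ℓ n (fun t => X t ω) Q + (s * (1 + ρ) ^ 2 * M * V₀ ρ c d / 4 +
        t / (s * ((n : ℝ) - 1))) ≤ risk μ ℓ X Q} ≤ ENNReal.ofReal (Real.exp (-t)) := by
  refine le_trans (measure_mono fun ω hω => ?_) (hX.measure_mean_ge_le hM hn hρ₀ hρ₁ hA hc hd hξ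
    (f := fun x y => -ℓ (x - act Q y)) (fun x y x' y' => by
      have := abs_loss_sub_le hℓ Q hQ x y x' y'
      rwa [neg_sub_neg, abs_sub_comm]) zero_le_one hρ₀.le hs hs₁ t)
  have hω' := hω
  rw [Set.mem_ofPred_eq] at hω'
  simp only [Set.mem_ofPred_eq, integral_neg, Finset.sum_neg_distrib, mul_neg]
  rw [empRisk, risk] at hω'
  linarith

/-- Upper deviations of the empirical risk. -/
theorem IsStationaryVAR.measure_risk_add_le (hX : IsStationaryVAR μ A ξ X) (hM : 1 ≤ M)
    (hn : 2 ≤ n) (hρ₀ : 0 < ρ) (hρ₁ : ρ < 1) (hA : specNorm A ≤ ρ) (hc : 0 < c) (hd : 0 < d)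
    (hξ : HasExpMoment μ c d (ξ 2)) (hℓ : LipschitzWith 1 ℓ) {Q : Mat M} (hQ : specNorm Q ≤ ρ)
    {s : ℝ} (hs : 0 < s) (hs₁ : s * (1 + ρ) * √M * δ₀ ρ c ≤ 1) (t : ℝ) :
    μ {ω | risk μ ℓ X Q + (s * (1 + ρ) ^ 2 * M * V₀ ρ c d / 4 +
        t / (s * ((n : ℝ) - 1))) ≤ empRisk ℓ n (fun t => X t ω) Q} ≤
      ENNReal.ofReal (Real.exp (-t)) := by
  refine le_trans (measure_mono fun ω hω => ?_) (hX.measure_mean_ge_le hM hn hρ₀ hρ₁ hA hc hd hξ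
    (f := fun x y => ℓ (x - act Q y)) (abs_loss_sub_le hℓ Q hQ) zero_le_one hρ₀.le hs hs₁ t)
  have hω' := hω
  rw [Set.mem_ofPred_eq] at hω'
  rw [empRisk, risk] at hω'
  simp only [Set.mem_ofPred_eq]
  linarith

theorem IsStationaryVAR.measure_meanNorm_ge_le (hX : IsStationaryVAR μ A ξ X) (hM : 1 ≤ M)
    (hn : 2 ≤ n) (hρ₀ : 0 < ρ) (hρ₁ : ρ < 1) (hA : specNorm A ≤ ρ) (hc : 0 < c) (hd : 0 < d)
    (hξ : HasExpMoment μ c d (ξ 2)) (t : ℝ) :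
    μ {ω | ∫ ω, ‖X 1 ω‖ ∂μ + (√M * V₀ ρ c d / (4 * δ₀ ρ c) +
        t * (√M * δ₀ ρ c) / ((n : ℝ) - 1)) ≤ meanNorm n (fun t => X t ω)} ≤
      ENNReal.ofReal (Real.exp (-t)) := by
  have hM' : (0 : ℝ) < M := by exact_mod_cast hM
  have hδ := δ₀_pos hρ₁ hc
  have hg : (0 : ℝ) < n - 1 := by
    have : (2 : ℝ) ≤ n := by exact_mod_cast hn
    linarith
  have hq : 0 < √(M : ℝ) := by positivity
  have hqq : √(M : ℝ) * √M = M := Real.mul_self_sqrt hM'.le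
  -- This `s` is the largest admissible one: it makes the parameter `s * (a + b) * √M * δ₀` equal to
  -- `1`.
  refine le_trans (measure_mono fun ω hω => ?_) (hX.measure_mean_ge_le hM hn hρ₀ hρ₁ hA hc hd hξ
    (f := fun _ y => ‖y‖) (a := 0) (b := 1) (s := 1 / (√M * δ₀ ρ c))
    (fun x y x' y' => by simpa using abs_norm_sub_norm_le y y') le_rfl zero_le_one (by positivity)
    (le_of_eq (by field_simp; ring)) t)
  have hω' := hω
  rw [Set.mem_ofPred_eq] at hω'
  rw [meanNorm] at hω'
  simp only [Set.mem_ofPred_eq]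
  refine le_trans (le_of_eq ?_) hω'
  have e1 : 1 / (√M * δ₀ ρ c) * (0 + 1) ^ 2 * M * V₀ ρ c d / 4 = √M * V₀ ρ c d / (4 * δ₀ ρ c) := by
    rw [← hqq]
    simp only [Real.sqrt_mul_self hq.le]
    field_simp
    ring
  rw [e1, add_assoc]
  congr 2
  field_simp

end Deviation

/-- The rate `√(𝒱₀ r log(9 r n) / (n - 1))`. -/
noncomputable def rate (ρ c d : ℝ) (n r : ℕ) : ℝ :=
  √(V₀ ρ c d * (r * Real.log (9 * r * n)) / ((n : ℝ) - 1))

/-- The confidence scale `√(𝒱₀ / (4 (n - 1) log(9 n)))`. -/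
noncomputable def confScale (ρ c d : ℝ) (n : ℕ) : ℝ :=
  √(V₀ ρ c d / (4 * ((n : ℝ) - 1) * Real.log (9 * n)))

/-! ### Algebra of the rate, the confidence scale and the penalty. -/

section Rates

variable {ρ c d : ℝ} {n r : ℕ}

theorem log_rank_pos (hn : 2 ≤ n) (hr : 1 ≤ r) : 0 < Real.log (9 * r * n) := by
  have h1 : (2 : ℝ) ≤ n := by exact_mod_cast hn
  have h2 : (1 : ℝ) ≤ r := by exact_mod_cast hr
  exact Real.log_pos (by nlinarith)

theorem log_le_log_rank (hn : 2 ≤ n) (hr : 1 ≤ r) :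
    Real.log (9 * n) ≤ Real.log (9 * r * n) := by
  have h1 : (2 : ℝ) ≤ n := by exact_mod_cast hn
  have h2 : (1 : ℝ) ≤ r := by exact_mod_cast hr
  exact Real.log_le_log (by positivity) (by nlinarith)

theorem rate_pos (hV : 0 < V₀ ρ c d) (hn : 2 ≤ n) (hr : 1 ≤ r) : 0 < rate ρ c d n r := by
  have h1 : (2 : ℝ) ≤ n := by exact_mod_cast hn
  have h2 : (0 : ℝ) < r := by exact_mod_cast hr
  have h3 := log_rank_pos hn hr
  have h4 : (0 : ℝ) < n - 1 := by linarith
  unfold rate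
  positivity

theorem rate_sq (hV : 0 < V₀ ρ c d) (hn : 2 ≤ n) (hr : 1 ≤ r) :
    rate ρ c d n r ^ 2 * ((n : ℝ) - 1) = V₀ ρ c d * (r * Real.log (9 * r * n)) := by
  have h1 : (2 : ℝ) ≤ n := by exact_mod_cast hn
  have h3 := log_rank_pos hn hr
  have h4 : (0 : ℝ) < n - 1 := by linarith
  rw [rate, Real.sq_sqrt (by positivity), div_mul_cancel₀ _ h4.ne']

theorem rate_one_le (hV : 0 < V₀ ρ c d) (hn : 2 ≤ n) (hr : 1 ≤ r) :
    rate ρ c d n 1 ≤ rate ρ c d n r := by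
  have h1 : (2 : ℝ) ≤ n := by exact_mod_cast hn
  have h2 : (1 : ℝ) ≤ r := by exact_mod_cast hr
  have h4 : (0 : ℝ) < n - 1 := by linarith
  have h5 := log_le_log_rank hn hr
  have h6 := log_rank_pos hn le_rfl
  unfold rate
  gcongr

/-- In this form the scale is the coefficient of `(1 + ρ) * t` in the deviation at the rank-one
Laplace parameter; larger ranks have a larger rate and hence a smaller coefficient. -/
theorem confScale_eq (hV : 0 < V₀ ρ c d) (hn : 2 ≤ n) :
    confScale ρ c d n = V₀ ρ c d / (2 * rate ρ c d n 1 * ((n : ℝ) - 1)) := by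
  have h1 : (2 : ℝ) ≤ n := by exact_mod_cast hn
  have h4 : (0 : ℝ) < n - 1 := by linarith
  have h5 := log_rank_pos hn le_rfl
  have h6 := rate_pos hV hn le_rfl
  have h7 := rate_sq hV hn le_rfl
  rw [confScale, Real.sqrt_eq_iff_mul_self_eq (by simp at h5; positivity) (by positivity)]
  simp only [Nat.cast_one, mul_one, one_mul] at h5 h7
  have : V₀ ρ c d / (2 * rate ρ c d n 1 * (n - 1)) * (V₀ ρ c d / (2 * rate ρ c d n 1 * (n - 1))) =
      V₀ ρ c d ^ 2 / (4 * (rate ρ c d n 1 ^ 2 * (n - 1)) * (n - 1)) := by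
    field_simp
    norm_num
  rw [this, h7]
  field_simp

theorem pen_eq (M : ℕ) :
    pen ρ c d M n r = 4 * (1 + ρ) * M * rate ρ c d n r := by
  have : 4 * V₀ ρ c d * (M : ℝ) ^ 2 * r * Real.log (9 * r * n) / ((n : ℝ) - 1) =
      (2 * M) ^ 2 * (V₀ ρ c d * (r * Real.log (9 * r * n)) / ((n : ℝ) - 1)) := by ring
  rw [pen, rate, this, Real.sqrt_mul (by positivity), Real.sqrt_sq (by positivity)]
  ring

/-- The sample size condition, in terms of the rate for rank one. -/
theorem sample_size_cond {M : ℕ} (hM : 1 ≤ M) (hρ : ρ < 1) (hc : 0 < c) (hd : 0 < d)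
    (h : ∃ r ∈ Finset.Icc 1 M,
      (n : ℝ) ≥ 1 + 16 * δ₀ ρ c ^ 2 * M * r * Real.log (9 * r * n) / V₀ ρ c d) :
    2 ≤ n ∧ 4 * rate ρ c d n 1 * √M * δ₀ ρ c ≤ V₀ ρ c d := by
  obtain ⟨r, hr, hnr⟩ := h
  have hr1 := (Finset.mem_Icc.1 hr).1
  have hV := V₀_pos hρ hc hd
  have hδ := δ₀_pos hρ hc
  have hM' : (1 : ℝ) ≤ M := by exact_mod_cast hM
  have hr' : (1 : ℝ) ≤ r := by exact_mod_cast hr1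
  have hn1 : 1 ≤ n := by
    rcases Nat.eq_zero_or_pos n with rfl | hn
    · norm_num at hnr
    · exact hn
  have hn1' : (1 : ℝ) ≤ n := by exact_mod_cast hn1
  have hlog : 0 < Real.log (9 * r * n) := Real.log_pos (by nlinarith)
  have hn2 : 2 ≤ n := by
    have : (1 : ℝ) < n := by
      have : 0 < 16 * δ₀ ρ c ^ 2 * M * r * Real.log (9 * r * n) / V₀ ρ c d := by positivity
      linarith
    exact_mod_cast this
  refine ⟨hn2, ?_⟩
  have hg : (0 : ℝ) < n - 1 := by
    have : (2 : ℝ) ≤ n := by exact_mod_cast hn2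
    linarith
  have hl1 := log_le_log_rank hn2 hr1
  have hl0 := log_rank_pos hn2 le_rfl
  have hrs := rate_sq hV hn2 le_rfl
  have hrp := rate_pos hV hn2 le_rfl
  simp only [Nat.cast_one, mul_one, one_mul] at hl0 hrs
  have h16 : 16 * δ₀ ρ c ^ 2 * M * Real.log (9 * n) ≤ V₀ ρ c d * ((n : ℝ) - 1) := by
    have h1 : 16 * δ₀ ρ c ^ 2 * M * r * Real.log (9 * r * n) / V₀ ρ c d ≤ n - 1 := by linarith
    rw [div_le_iff₀ hV] at h1
    calc 16 * δ₀ ρ c ^ 2 * M * Real.log (9 * n)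
        ≤ 16 * δ₀ ρ c ^ 2 * M * (r * Real.log (9 * r * n)) := by
          gcongr
          nlinarith
      _ ≤ _ := by linarith
  refine le_of_sq_le_sq ?_ hV.le
  rw [mul_pow, mul_pow, mul_pow, Real.sq_sqrt (by positivity)]
  have h2 : 4 ^ 2 * rate ρ c d n 1 ^ 2 * M * δ₀ ρ c ^ 2 * ((n : ℝ) - 1) ≤
      V₀ ρ c d ^ 2 * ((n : ℝ) - 1) := by
    calc _ = V₀ ρ c d * (16 * δ₀ ρ c ^ 2 * M * Real.log (9 * n)) := by
          linear_combination 16 * M * δ₀ ρ c ^ 2 * hrs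
      _ ≤ V₀ ρ c d * (V₀ ρ c d * ((n : ℝ) - 1)) := by gcongr
      _ = _ := by ring
  exact le_of_mul_le_mul_right h2 hg

end Rates

/-! ### The good event, by union bounds. -/

section Events

variable {Ω : Type*} [MeasurableSpace Ω] {μ : Measure Ω} [IsProbabilityMeasure μ] {M n : ℕ}
  {A : Mat M} {ξ X : ℕ → Ω → Vec M} {ρ c d : ℝ} {ℓ : Vec M → ℝ}

/-- The Laplace parameter is `s = 2 * rate / ((1 + ρ) * V₀)`. The variance term costs `(1 + ρ) * M *
rate / 2` and the exponent `2 M r log(9rn)`, reserved for the net, costs `(1 + ρ) * M * rate`;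
together they stay below `2 * (1 + ρ) * M * rate`. `hgood` says that `s` is admissible. -/
theorem IsStationaryVAR.measure_empRisk_add_rate_le (hX : IsStationaryVAR μ A ξ X) (hM : 1 ≤ M)
    (hn : 2 ≤ n) (hρ₀ : 0 < ρ) (hρ₁ : ρ < 1) (hA : specNorm A ≤ ρ) (hc : 0 < c) (hd : 0 < d)
    (hξ : HasExpMoment μ c d (ξ 2)) (hℓ : LipschitzWith 1 ℓ) {r : ℕ} (hr : 1 ≤ r)
    (hgood : 2 * rate ρ c d n r * √M * δ₀ ρ c ≤ V₀ ρ c d) {Q : Mat M} (hQ : specNorm Q ≤ ρ)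
    {t : ℝ} (ht : 0 ≤ t) :
    μ {ω | empRisk ℓ n (fun t => X t ω) Q + (2 * (1 + ρ) * M * rate ρ c d n r +
        (1 + ρ) * t * confScale ρ c d n) ≤ risk μ ℓ X Q} ≤
      ENNReal.ofReal (Real.exp (-(2 * M * (r * Real.log (9 * r * n)) + t))) := by
  have hV := V₀_pos hρ₁ hc hd
  have hT := rate_pos hV hn hr
  have hT1 := rate_pos hV hn le_rfl
  have hT1r := rate_one_le hV hn hr
  have hsq := rate_sq hV hn hr
  have hg : (0 : ℝ) < n - 1 := by
    have : (2 : ℝ) ≤ n := by exact_mod_cast hn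
    linarith
  refine le_trans (measure_mono fun ω hω => ?_) (hX.measure_empRisk_add_le hM hn hρ₀ hρ₁ hA hc hd
    hξ hℓ hQ (s := 2 * rate ρ c d n r / ((1 + ρ) * V₀ ρ c d)) (by positivity) ?_ _)
  · rw [Set.mem_ofPred_eq] at hω ⊢
    refine le_trans (add_le_add le_rfl ?_) hω
    have e1 : 2 * rate ρ c d n r / ((1 + ρ) * V₀ ρ c d) * (1 + ρ) ^ 2 * M * V₀ ρ c d / 4 =
        (1 + ρ) * M * rate ρ c d n r / 2 := by field_simp; norm_num
    have e2 : (2 * M * (r * Real.log (9 * r * n)) + t) /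
        (2 * rate ρ c d n r / ((1 + ρ) * V₀ ρ c d) * ((n : ℝ) - 1)) =
        (1 + ρ) * M * rate ρ c d n r +
          (1 + ρ) * t * (V₀ ρ c d / (2 * rate ρ c d n r * ((n : ℝ) - 1))) := by
      generalize Real.log (9 * r * n) = l at hsq ⊢
      field_simp
      linear_combination -2 * M * hsq
    have e3 : V₀ ρ c d / (2 * rate ρ c d n r * ((n : ℝ) - 1)) ≤ confScale ρ c d n := by
      rw [confScale_eq hV hn]
      gcongr
    have e4 : (1 + ρ) * t * (V₀ ρ c d / (2 * rate ρ c d n r * ((n : ℝ) - 1))) ≤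
        (1 + ρ) * t * confScale ρ c d n := by gcongr
    have e5 : 0 ≤ (1 + ρ) * M * rate ρ c d n r := by positivity
    rw [e1, e2]
    linarith
  · rw [show 2 * rate ρ c d n r / ((1 + ρ) * V₀ ρ c d) * (1 + ρ) * √M * δ₀ ρ c =
      2 * rate ρ c d n r * √M * δ₀ ρ c / V₀ ρ c d by field_simp]
    exact (div_le_one hV).2 hgood

/-- Only one reference matrix per rank is needed in this direction. There is no net to pay for, so
the rank-one parameter serves for all ranks. -/
theorem IsStationaryVAR.measure_risk_add_rate_le (hX : IsStationaryVAR μ A ξ X) (hM : 1 ≤ M)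
    (hn : 2 ≤ n) (hρ₀ : 0 < ρ) (hρ₁ : ρ < 1) (hA : specNorm A ≤ ρ) (hc : 0 < c) (hd : 0 < d)
    (hξ : HasExpMoment μ c d (ξ 2)) (hℓ : LipschitzWith 1 ℓ)
    (hgood : 2 * rate ρ c d n 1 * √M * δ₀ ρ c ≤ V₀ ρ c d) {Q : Mat M} (hQ : specNorm Q ≤ ρ)
    (t : ℝ) :
    μ {ω | risk μ ℓ X Q + (2 * (1 + ρ) * M * rate ρ c d n 1 +
        (1 + ρ) * t * confScale ρ c d n) ≤ empRisk ℓ n (fun t => X t ω) Q} ≤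
      ENNReal.ofReal (Real.exp (-t)) := by
  have hV := V₀_pos hρ₁ hc hd
  have hT := rate_pos hV hn le_rfl
  have hg : (0 : ℝ) < n - 1 := by
    have : (2 : ℝ) ≤ n := by exact_mod_cast hn
    linarith
  refine le_trans (measure_mono fun ω hω => ?_) (hX.measure_risk_add_le hM hn hρ₀ hρ₁ hA hc hd
    hξ hℓ hQ (s := 2 * rate ρ c d n 1 / ((1 + ρ) * V₀ ρ c d)) (by positivity) ?_ t)
  · rw [Set.mem_ofPred_eq] at hω ⊢
    refine le_trans (add_le_add le_rfl ?_) hω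
    have e1 : 2 * rate ρ c d n 1 / ((1 + ρ) * V₀ ρ c d) * (1 + ρ) ^ 2 * M * V₀ ρ c d / 4 =
        (1 + ρ) * M * rate ρ c d n 1 / 2 := by field_simp; norm_num
    have e2 : t / (2 * rate ρ c d n 1 / ((1 + ρ) * V₀ ρ c d) * ((n : ℝ) - 1)) =
        (1 + ρ) * t * confScale ρ c d n := by
      rw [confScale_eq hV hn]
      field_simp
    have e5 : 0 ≤ (1 + ρ) * M * rate ρ c d n 1 := by positivity
    rw [e1, e2]
    linarith
  · rw [show 2 * rate ρ c d n 1 / ((1 + ρ) * V₀ ρ c d) * (1 + ρ) * √M * δ₀ ρ c =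
      2 * rate ρ c d n 1 * √M * δ₀ ρ c / V₀ ρ c d by field_simp]
    exact (div_le_one hV).2 hgood

/-- The event of the oracle inequality: the risks are controlled on finite nets of the classes of
low-rank matrices and at given reference matrices, and so is the size of the predictors. -/
theorem IsStationaryVAR.exists_event (hX : IsStationaryVAR μ A ξ X) (hM : 1 ≤ M)
    (hn : 2 ≤ n) (hρ₀ : 0 < ρ) (hρ₁ : ρ < 1) (hA : specNorm A ≤ ρ) (hc : 0 < c) (hd : 0 < d)
    (hξ : HasExpMoment μ c d (ξ 2)) (hℓ : LipschitzWith 1 ℓ)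
    (hgood : 2 * rate ρ c d n 1 * √M * δ₀ ρ c ≤ V₀ ρ c d) (net : ℕ → Finset (Mat M))
    (hnet : ∀ r, ∀ Q ∈ net r, specNorm Q ≤ ρ)
    (hcard : ∀ r, ((net r).card : ℝ) ≤ (9 * n) ^ (2 * (M * r))) (Qref : ℕ → Mat M)
    (hQref : ∀ r, specNorm (Qref r) ≤ ρ) {η : ℝ} (hη : 0 < η) (hη₁ : η < 1) :
    ∃ S : Set Ω, MeasurableSet S ∧ ENNReal.ofReal (1 - η) ≤ μ S ∧ ∀ ω ∈ S,
      (∀ r ∈ Finset.Icc 1 M, 2 * rate ρ c d n r * √M * δ₀ ρ c ≤ V₀ ρ c d → ∀ Q ∈ net r,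
        risk μ ℓ X Q ≤ empRisk ℓ n (fun t => X t ω) Q + (2 * (1 + ρ) * M * rate ρ c d n r +
          (1 + ρ) * Real.log (4 * M / η) * confScale ρ c d n)) ∧
      (∀ r ∈ Finset.Icc 1 M, empRisk ℓ n (fun t => X t ω) (Qref r) ≤ risk μ ℓ X (Qref r) +
        (2 * (1 + ρ) * M * rate ρ c d n 1 +
          (1 + ρ) * Real.log (4 * M / η) * confScale ρ c d n)) ∧
      meanNorm n (fun t => X t ω) ≤ ∫ ω, ‖X 1 ω‖ ∂μ + (√M * V₀ ρ c d / (4 * δ₀ ρ c) +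
        Real.log (2 / η) * (√M * δ₀ ρ c) / ((n : ℝ) - 1)) := by
  classical
  have hM' : (1 : ℝ) ≤ M := by exact_mod_cast hM
  have hn' : (2 : ℝ) ≤ n := by exact_mod_cast hn
  -- Each of the at most `M` ranks gets probability `η / (4M)` in each direction, which costs `η /
  -- 2` in total; the predictor norms get the other `η / 2`.
  set L := Real.log (4 * M / η) with hL
  have hL0 : 0 ≤ L := Real.log_nonneg (by rw [le_div_iff₀ hη]; linarith)
  have hexpL : Real.exp (-L) = η / (4 * M) := by
    rw [Real.exp_neg, hL, Real.exp_log (by positivity), inv_div]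
  set G := (Finset.Icc 1 M).filter fun r => 2 * rate ρ c d n r * √M * δ₀ ρ c ≤ V₀ ρ c d with hG
  set B₁ : Set Ω := ⋃ r ∈ G, ⋃ Q ∈ net r, {ω | empRisk ℓ n (fun t => X t ω) Q +
    (2 * (1 + ρ) * M * rate ρ c d n r + (1 + ρ) * L * confScale ρ c d n) ≤ risk μ ℓ X Q} with hB₁
  set B₂ : Set Ω := ⋃ r ∈ Finset.Icc 1 M, {ω | risk μ ℓ X (Qref r) +
    (2 * (1 + ρ) * M * rate ρ c d n 1 + (1 + ρ) * L * confScale ρ c d n) ≤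
      empRisk ℓ n (fun t => X t ω) (Qref r)} with hB₂
  set B₃ : Set Ω := {ω | ∫ ω, ‖X 1 ω‖ ∂μ + (√M * V₀ ρ c d / (4 * δ₀ ρ c) +
    Real.log (2 / η) * (√M * δ₀ ρ c) / ((n : ℝ) - 1)) ≤ meanNorm n (fun t => X t ω)} with hB₃
  have hm₁ : MeasurableSet B₁ := Finset.measurableSet_biUnion _ fun r _ =>
    Finset.measurableSet_biUnion _ fun Q _ =>
      measurableSet_le ((hX.measurable_empRisk hℓ Q).add_const _) measurable_const
  have hm₂ : MeasurableSet B₂ := Finset.measurableSet_biUnion _ fun r _ =>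
    measurableSet_le measurable_const (hX.measurable_empRisk hℓ _)
  have hm₃ : MeasurableSet B₃ := measurableSet_le measurable_const hX.measurable_meanNorm
  have hμ₁ : μ B₁ ≤ ENNReal.ofReal (η / 4) := by
    have hr : ∀ r ∈ G, μ (⋃ Q ∈ net r, {ω | empRisk ℓ n (fun t => X t ω) Q +
        (2 * (1 + ρ) * M * rate ρ c d n r + (1 + ρ) * L * confScale ρ c d n) ≤ risk μ ℓ X Q}) ≤
        ENNReal.ofReal (η / (4 * M)) := fun r hr => by
      obtain ⟨hrM, hrg⟩ := Finset.mem_filter.1 hr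
      have hr1 := (Finset.mem_Icc.1 hrM).1
      refine (measure_biUnion_finset_le _ _).trans ((Finset.sum_le_sum fun Q hQ =>
        hX.measure_empRisk_add_rate_le hM hn hρ₀ hρ₁ hA hc hd hξ hℓ hr1 hrg (hnet r Q hQ) hL0).trans ?_)
      rw [Finset.sum_const, nsmul_eq_mul, ← ENNReal.ofReal_natCast,
        ← ENNReal.ofReal_mul (Nat.cast_nonneg _)]
      refine ENNReal.ofReal_le_ofReal ?_
      -- The reserved factor `exp (-2 M r log(9rn))` cancels the cardinality `(9n)^(2Mr)` of the
      -- net.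
      rw [neg_add, Real.exp_add, hexpL, ← mul_assoc]
      refine mul_le_of_le_one_left (by positivity) ?_
      rw [Real.exp_neg, ← div_eq_mul_inv, div_le_one (Real.exp_pos _)]
      refine (hcard r).trans ?_
      rw [← Real.exp_log (show (0 : ℝ) < 9 * n by positivity), ← Real.exp_nat_mul]
      refine Real.exp_le_exp.2 ?_
      push_cast
      have := log_le_log_rank hn hr1
      calc 2 * ((M : ℝ) * r) * Real.log (9 * n) ≤ 2 * ((M : ℝ) * r) * Real.log (9 * r * n) := by
            gcongr
        _ = _ := by ring
    refine (measure_biUnion_finset_le _ _).trans ((Finset.sum_le_sum hr).trans ?_)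
    rw [Finset.sum_const, nsmul_eq_mul, ← ENNReal.ofReal_natCast,
      ← ENNReal.ofReal_mul (Nat.cast_nonneg _)]
    refine ENNReal.ofReal_le_ofReal ?_
    have hGM : (G.card : ℝ) ≤ M := by
      have := Finset.card_filter_le (Finset.Icc 1 M)
        (fun r => 2 * rate ρ c d n r * √M * δ₀ ρ c ≤ V₀ ρ c d)
      rw [Nat.card_Icc, Nat.add_sub_cancel] at this
      exact_mod_cast this
    calc (G.card : ℝ) * (η / (4 * M)) ≤ M * (η / (4 * M)) := by gcongr
      _ = η / 4 := by field_simp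
  have hμ₂ : μ B₂ ≤ ENNReal.ofReal (η / 4) := by
    refine (measure_biUnion_finset_le _ _).trans ((Finset.sum_le_sum fun r _ =>
      hX.measure_risk_add_rate_le hM hn hρ₀ hρ₁ hA hc hd hξ hℓ hgood (hQref r) L).trans ?_)
    rw [Finset.sum_const, nsmul_eq_mul, ← ENNReal.ofReal_natCast,
      ← ENNReal.ofReal_mul (Nat.cast_nonneg _), hexpL, Nat.card_Icc, Nat.add_sub_cancel]
    refine ENNReal.ofReal_le_ofReal (le_of_eq ?_)
    field_simp
  have hμ₃ : μ B₃ ≤ ENNReal.ofReal (η / 2) := by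
    refine (hX.measure_meanNorm_ge_le hM hn hρ₀ hρ₁ hA hc hd hξ _).trans (le_of_eq ?_)
    rw [Real.exp_neg, Real.exp_log (by positivity), inv_div]
  have hμ : μ (B₁ ∪ B₂ ∪ B₃) ≤ ENNReal.ofReal η := by
    refine (measure_union_le _ _).trans ((add_le_add ((measure_union_le _ _).trans
      (add_le_add hμ₁ hμ₂)) hμ₃).trans (le_of_eq ?_))
    rw [← ENNReal.ofReal_add (by positivity) (by positivity),
      ← ENNReal.ofReal_add (by positivity) (by positivity)]
    congr 1
    ring
  refine ⟨(B₁ ∪ B₂ ∪ B₃)ᶜ, ((hm₁.union hm₂).union hm₃).compl, ?_, fun ω hω => ⟨?_, ?_, ?_⟩⟩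
  · rw [prob_compl_eq_one_sub ((hm₁.union hm₂).union hm₃), ENNReal.ofReal_sub _ hη.le,
      ENNReal.ofReal_one]
    exact tsub_le_tsub_left hμ 1
  · intro r hr hrg Q hQ
    by_contra hlt
    refine hω (Or.inl (Or.inl ?_))
    exact Set.mem_biUnion (Finset.mem_coe.2 (Finset.mem_filter.2 ⟨hr, hrg⟩))
      (Set.mem_biUnion (Finset.mem_coe.2 hQ) (not_le.1 hlt).le)
  · intro r hr
    by_contra hlt
    refine hω (Or.inl (Or.inr ?_))
    exact Set.mem_biUnion (Finset.mem_coe.2 hr) (not_le.1 hlt).le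
  · by_contra hlt
    exact hω (Or.inr (not_le.1 hlt).le)

end Events

/-! ### Deterministic comparison of risk and empirical risk. -/

section Oracle

variable {M n : ℕ} {ρ c d : ℝ} {ℓ : Vec M → ℝ} {x : ℕ → Vec M} {R : Mat M → ℝ} {m Z C : ℝ}

/-- From a net to the whole class of low-rank matrices: on the classes for which the deviation
inequality is not available, the penalty dominates the oscillation of the risk. -/
theorem risk_le_empRisk_add (hM : 1 ≤ M) (hn : 2 ≤ n) (hρ₀ : 0 < ρ) (hρ₁ : ρ < 1) (hc : 0 < c)
    (hd : 0 < d) (hℓ : LipschitzWith 1 ℓ)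
    (hsize : 4 * rate ρ c d n 1 * √M * δ₀ ρ c ≤ V₀ ρ c d)
    (hR : ∀ Q Q', |R Q - R Q'| ≤ ‖act Q - act Q'‖ * m)
    (hm : m ≤ √M * (V₀ ρ c d / (8 * δ₀ ρ c))) (hZ : 0 ≤ Z)
    (hZC : Z ≤ C / 2) (hmean : meanNorm n x ≤ m + (√M * V₀ ρ c d / (4 * δ₀ ρ c) + Z))
    {net : ℕ → Finset (Mat M)}
    (hnet : ∀ r, ∀ Q ∈ lowRankSet M ρ r, ∃ Q' ∈ net r, ‖act Q - act Q'‖ ≤ ρ / (2 * n))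
    (hdev : ∀ r ∈ Finset.Icc 1 M, 2 * rate ρ c d n r * √M * δ₀ ρ c ≤ V₀ ρ c d → ∀ Q ∈ net r,
        R Q ≤ empRisk ℓ n x Q + (2 * (1 + ρ) * M * rate ρ c d n r + (1 + ρ) * C))
    {r : ℕ} (hr : r ∈ Finset.Icc 1 M) {Q : Mat M} (hQ : Q ∈ lowRankSet M ρ r) :
    R Q ≤ empRisk ℓ n x Q + pen ρ c d M n r + 2 * (1 + ρ) * C +
      (√M / n * (V₀ ρ c d / (2 * δ₀ ρ c)) + 2 * Z / n) := by
  have hV := V₀_pos hρ₁ hc hd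
  have hδ := δ₀_pos hρ₁ hc
  have hM' : (1 : ℝ) ≤ M := by exact_mod_cast hM
  have hn' : (2 : ℝ) ≤ n := by exact_mod_cast hn
  have hn0 : (0 : ℝ) < n := by linarith
  have hq : 0 < √(M : ℝ) := by positivity
  have hqq : √(M : ℝ) * √M = M := Real.mul_self_sqrt (by linarith)
  -- The scale of the predictor norms: `m ≤ B / 8` and the empirical mean norm is at most `m + B / 4
  -- + Z`, so `R - R_n` is Lipschitz with constant `B / 2 + Z`.
  set B := √M * V₀ ρ c d / δ₀ ρ c with hB
  have hB0 : 0 < B := by positivity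
  have hmB : m ≤ B / 8 := hm.trans_eq (by rw [hB]; field_simp)
  have hBn : √M / n * (V₀ ρ c d / (2 * δ₀ ρ c)) = B / (2 * n) := by rw [hB]; field_simp
  have hmB' : √M * V₀ ρ c d / (4 * δ₀ ρ c) = B / 4 := by rw [hB]; field_simp
  rw [hmB'] at hmean
  rw [hBn]
  have hmeans : m + meanNorm n x ≤ B / 2 + Z := by linarith
  have hlip : ∀ Q Q', R Q - empRisk ℓ n x Q ≤ R Q' - empRisk ℓ n x Q' +
      ‖act Q - act Q'‖ * (B / 2 + Z) := fun Q Q' => by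
    have h1 := (abs_le.1 (hR Q Q')).2
    have h2 := (abs_le.1 (abs_empRisk_sub_le hℓ hn x Q Q')).1
    have h3 := mul_le_mul_of_nonneg_left hmeans (norm_nonneg (act Q - act Q'))
    linarith
  have hgood : ∀ r ∈ Finset.Icc 1 M, 2 * rate ρ c d n r * √M * δ₀ ρ c ≤ V₀ ρ c d →
      ∀ Q ∈ lowRankSet M ρ r, R Q - empRisk ℓ n x Q ≤ 2 * (1 + ρ) * M * rate ρ c d n r +
        (1 + ρ) * C + (B / (2 * n) + 2 * Z / n) := by
    intro r hr hg Q hQ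
    obtain ⟨Q', hQ', hQQ'⟩ := hnet r Q hQ
    have h1 := hlip Q Q'
    have h2 := hdev r hr hg Q' hQ'
    have h3 : ‖act Q - act Q'‖ * (B / 2 + Z) ≤ 1 / n * (B / 2 + Z) := by
      refine mul_le_mul_of_nonneg_right (hQQ'.trans ?_) (by positivity)
      rw [div_le_div_iff₀ (by positivity) hn0]
      nlinarith
    have h4 : 1 / (n : ℝ) * (B / 2 + Z) ≤ B / (2 * n) + 2 * Z / n := by
      have : 1 / (n : ℝ) * (B / 2 + Z) = B / (2 * n) + 2 * Z / n - Z / n := by field_simp; ring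
      have : 0 ≤ Z / n := by positivity
      linarith
    linarith
  have hC0 : 0 ≤ C := by linarith
  have hκC : 0 ≤ (1 + ρ) * C := by positivity
  have hr1 := (Finset.mem_Icc.1 hr).1
  have hT := rate_pos hV hn hr1
  rw [pen_eq]
  rcases le_or_gt (2 * rate ρ c d n r * √M * δ₀ ρ c) (V₀ ρ c d) with hg | hg
  · have h1 := hgood r hr hg Q hQ
    have h2 : 0 ≤ (1 + ρ) * M * rate ρ c d n r := by positivity
    linarith
  -- Rank too large for its own deviation bound: `Q` is compared with `0`, which lies in the
  -- rank-one class. The cost is at most `(1 + ρ) * B` up to the `C` terms and the remainder of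
  -- order `1 / n`, while failure of the condition means `B / 2 ≤ M * rate`, so the penalty is at
  -- least `2 * (1 + ρ) * B`.
  · have h0 := hgood 1 (Finset.mem_Icc.2 ⟨le_rfl, hM⟩) (by
      have : 0 ≤ rate ρ c d n 1 * √M * δ₀ ρ c :=
        mul_nonneg (mul_nonneg (rate_pos hV hn le_rfl).le hq.le) hδ.le
      linarith) 0 (zero_mem_lowRankSet hρ₀.le 1)
    have h1 := hlip Q 0
    have h2 : ‖act Q - act 0‖ ≤ ρ := by
      have : act (0 : Mat M) = 0 := by simp [act]
      rw [this, sub_zero]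
      exact hQ.2
    have h3 : ‖act Q - act 0‖ * (B / 2 + Z) ≤ ρ * (B / 2 + Z) := by gcongr
    have h4 : M * rate ρ c d n 1 ≤ B / 4 := by
      rw [hB, div_div, le_div_iff₀ (by positivity)]
      calc M * rate ρ c d n 1 * (δ₀ ρ c * 4) = √M * (4 * rate ρ c d n 1 * √M * δ₀ ρ c) := by
            linear_combination (-4 * rate ρ c d n 1 * δ₀ ρ c) * hqq
        _ ≤ √M * V₀ ρ c d := by gcongr
    have h5 : B / 2 ≤ M * rate ρ c d n r := by
      rw [hB, div_div, div_le_iff₀ (by positivity)]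
      calc √M * V₀ ρ c d ≤ √M * (2 * rate ρ c d n r * √M * δ₀ ρ c) := by gcongr
        _ = M * rate ρ c d n r * (δ₀ ρ c * 2) := by
            linear_combination (2 * rate ρ c d n r * δ₀ ρ c) * hqq
    have h6 : (1 + ρ) * (M * rate ρ c d n 1) ≤ (1 + ρ) * (B / 4) := by gcongr
    have h7 : (1 + ρ) * (B / 2) ≤ (1 + ρ) * (M * rate ρ c d n r) := by gcongr
    have h8 : ρ * Z ≤ ρ * (C / 2) := by gcongr
    have h9 : 0 ≤ ρ * B := by positivity
    have h10 : 0 ≤ ρ * C := by positivity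
    linarith

end Oracle

end LowRankVAR

/-! ### Assembly of the oracle inequality. -/

open LowRankVAR in
theorem theorem2 {Ω : Type*} [MeasurableSpace Ω] (μ : Measure Ω) [IsProbabilityMeasure μ]
    (M n r₀ : ℕ) (ρ c d : ℝ)
    -- the transition matrix belongs to `𝓜(ρ, r₀)`
    (hρ₀ : 0 < ρ) (hρ₁ : ρ < 1) (hr₀ : r₀ ∈ Finset.Icc 1 M)
    (A : Mat M) (hA : A ∈ lowRankSet M ρ r₀)
    -- the process
    (ξ X : ℕ → Ω → Vec M) (hX : IsStationaryVAR μ A ξ X)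
    -- exponential moments of the noise
    (hc : 0 < c) (hd : 0 < d) (hξ : ∀ t, 2 ≤ t → HasExpMoment μ c d (ξ t))
    -- Lipschitz loss
    (ℓ : Vec M → ℝ) (L : ℝ≥0) (hL : L ≤ 1) (hℓ : LipschitzWith L ℓ)
    -- the sample size condition, for at least one rank
    (hn : ∃ r ∈ Finset.Icc 1 M,
      (n : ℝ) ≥ 1 + 16 * δ₀ ρ c ^ 2 * M * r * Real.log (9 * r * n) / V₀ ρ c d)
    -- fixed-rank estimators and selected rank
    (Ahat : ℕ → Ω → Mat M)
    (hAhat : ∀ r ∈ Finset.Icc 1 M, ∀ ω, IsERM ℓ n (fun t => X t ω) ρ r (Ahat r ω))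
    (rhat : Ω → ℕ)
    (hrhat : ∀ ω, IsSelectedRank ℓ n (fun t => X t ω) ρ c d (fun r => Ahat r ω) (rhat ω))
    (η : ℝ) (hη : 0 < η) :
    -- the errors `R(Q)` are well defined and their minima over `𝓜(ρ, r)` exist
    (∀ Q : Mat M, Integrable (fun ω => ℓ (X 2 ω - act Q (X 1 ω))) μ) ∧
    (∀ r ∈ Finset.Icc 1 (rBar ρ c d M n),
      ∃ Q ∈ lowRankSet M ρ r, IsMinOn (risk μ ℓ X) (lowRankSet M ρ r) Q) ∧
    -- the oracle inequality holds on an event of probability at least `1 - η`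
    ∃ S : Set Ω, MeasurableSet S ∧ ENNReal.ofReal (1 - η) ≤ μ S ∧ ∀ ω ∈ S,
      risk μ ℓ X (Ahat (rhat ω) ω) ≤
        (⨅ r : Finset.Icc 1 (rBar ρ c d M n),
          ((⨅ Q : lowRankSet M ρ r, risk μ ℓ X Q) +
            4 * (1 + ρ) * √(4 * V₀ ρ c d * (M : ℝ) ^ 2 * (r : ℕ) * Real.log (9 * (r : ℕ) * n)
              / ((n : ℝ) - 1))))
        + 3 * (1 + ρ) * Real.log (4 * M / η)
            * √(V₀ ρ c d / (4 * ((n : ℝ) - 1) * Real.log (9 * n)))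
        + √(M : ℝ) / n * (3 * Real.exp 1 * d * c / (1 - ρ) + V₀ ρ c d / (2 * δ₀ ρ c))
        + 2 * δ₀ ρ c * √(M : ℝ) / (n * ((n : ℝ) - 1)) * Real.log (2 / η) := by
  obtain ⟨hr₀1, hr₀M⟩ := Finset.mem_Icc.1 hr₀
  have hM : 1 ≤ M := hr₀1.trans hr₀M
  have hℓ' : LipschitzWith 1 ℓ := hℓ.weaken hL
  have hξ2 := hξ 2 le_rfl
  have hV := V₀_pos hρ₁ hc hd
  have hδ := δ₀_pos hρ₁ hc
  have h1ρ : 0 < 1 - ρ := by linarith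
  obtain ⟨hn2, hsize⟩ := sample_size_cond hM hρ₁ hc hd hn
  obtain ⟨hint1, hm⟩ := hX.integrable_norm_init hM hρ₁ hA.2 hc hd hξ2
  have hint := hX.integrable_loss hM hρ₁ hA.2 hc hd hξ2 hℓ'
  have hlip := abs_risk_sub_le (μ := μ) (X := X) hℓ' hint1 hint
  have hmin : ∀ r, ∃ Q ∈ lowRankSet M ρ r, IsMinOn (risk μ ℓ X) (lowRankSet M ρ r) Q :=
    fun r => exists_isMinOn_lowRankSet hρ₀.le r fun Q Q' => (hlip Q Q').trans_eq (mul_comm _ _)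
  refine ⟨hint, fun r _ => hmin r, ?_⟩
  -- For `η ≥ 1` the required probability is at most `0` and the empty event will do.
  rcases le_or_gt 1 η with hη₁ | hη₁
  · exact ⟨∅, MeasurableSet.empty, by simp [ENNReal.ofReal_of_nonpos (sub_nonpos.2 hη₁)], by simp⟩
  choose Qs hQs hQsmin using hmin
  choose net hnet₁ hnet₂ hnet₃ using fun r => exists_net_lowRankSet (M := M) hρ₀ r
    (show 1 ≤ n by omega)
  have hM' : (1 : ℝ) ≤ M := by exact_mod_cast hM
  have hn' : (2 : ℝ) ≤ n := by exact_mod_cast hn2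
  have hg : (0 : ℝ) < n - 1 := by linarith
  have hq : 0 < √(M : ℝ) := by positivity
  have hT1 := rate_pos hV hn2 le_rfl
  have hsize2 : 2 * rate ρ c d n 1 * √M * δ₀ ρ c ≤ V₀ ρ c d := by
    have : 0 ≤ rate ρ c d n 1 * √M * δ₀ ρ c := by positivity
    linarith
  obtain ⟨S, hSm, hSμ, hS⟩ := hX.exists_event hM hn2 hρ₀ hρ₁ hA.2 hc hd hξ2 hℓ' hsize2 net hnet₁
    hnet₃ Qs (fun r => (hQs r).2) hη hη₁
  refine ⟨S, hSm, hSμ, fun ω hω => ?_⟩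
  obtain ⟨hdev, href, hmean⟩ := hS ω hω
  set L' := Real.log (4 * M / η) with hL'
  set C := L' * confScale ρ c d n with hC
  set Z := Real.log (2 / η) * (√M * δ₀ ρ c) / ((n : ℝ) - 1) with hZ
  have hlog2 : 0 ≤ Real.log (2 / η) := Real.log_nonneg (by rw [le_div_iff₀ hη]; linarith)
  have hlogL : Real.log (2 / η) ≤ L' := Real.log_le_log (by positivity) (by gcongr; linarith)
  have hZ0 : 0 ≤ Z := by positivity
  -- The sample size condition says exactly that `√M * δ₀ / (n - 1)` is at most half the confidence
  -- scale; besides, `2 / η ≤ 4M / η`.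
  have hZC : Z ≤ C / 2 := by
    have h1 : √M * δ₀ ρ c / ((n : ℝ) - 1) ≤ confScale ρ c d n / 2 := by
      rw [confScale_eq hV hn2, div_div, div_le_div_iff₀ hg (by positivity)]
      nlinarith [mul_le_mul_of_nonneg_right hsize hg.le]
    have h2 : 0 ≤ √M * δ₀ ρ c / ((n : ℝ) - 1) := by positivity
    calc Z = Real.log (2 / η) * (√M * δ₀ ρ c / ((n : ℝ) - 1)) := by rw [hZ]; ring
      _ ≤ L' * (confScale ρ c d n / 2) := mul_le_mul hlogL h1 h2 (hlog2.trans hlogL)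
      _ = C / 2 := by rw [hC]; ring
  have hmV : ∫ ω, ‖X 1 ω‖ ∂μ ≤ √M * (V₀ ρ c d / (8 * δ₀ ρ c)) :=
    hm.trans (mul_le_mul_of_nonneg_left (mean_norm_const_le hρ₀ hρ₁ hc hd) hq.le)
  have hupper : ∀ r ∈ Finset.Icc 1 M, ∀ Q ∈ lowRankSet M ρ r,
      risk μ ℓ X Q ≤ empRisk ℓ n (fun t => X t ω) Q + pen ρ c d M n r + 2 * (1 + ρ) * C +
        (√M / n * (V₀ ρ c d / (2 * δ₀ ρ c)) + 2 * Z / n) := fun r hr Q hQ =>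
    risk_le_empRisk_add hM hn2 hρ₀ hρ₁ hc hd hℓ' hsize hlip hmV hZ0 hZC hmean hnet₂
      (fun r hr hgr Q hQ => (hdev r hr hgr Q hQ).trans_eq (by rw [hC]; ring)) hr hQ
  have hbar : rBar ρ c d M n ≤ M := Finset.sup_le fun r hr =>
    (Finset.mem_Icc.1 (Finset.mem_filter.1 hr).1).2
  have hIcc : ∀ r ∈ Finset.Icc 1 (rBar ρ c d M n), r ∈ Finset.Icc 1 M := fun r hr =>
    Finset.Icc_subset_Icc le_rfl hbar hr
  obtain ⟨hsel, hselmin⟩ := hrhat ω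
  have hne : Nonempty (Finset.Icc 1 (rBar ρ c d M n)) := ⟨⟨rhat ω, hsel⟩⟩
  have hconf : √(V₀ ρ c d / (4 * ((n : ℝ) - 1) * Real.log (9 * n))) = confScale ρ c d n := rfl
  rw [hconf]
  -- The mean predictor norm is already absorbed in `V₀ / (2 * δ₀)`, so the term `3 e d c / (1 - ρ)`
  -- is pure slack.
  have hrest : √(M : ℝ) / n * (V₀ ρ c d / (2 * δ₀ ρ c)) + 2 * Z / n ≤
      √(M : ℝ) / n * (3 * Real.exp 1 * d * c / (1 - ρ) + V₀ ρ c d / (2 * δ₀ ρ c)) +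
        2 * δ₀ ρ c * √(M : ℝ) / (n * ((n : ℝ) - 1)) * Real.log (2 / η) := by
    have h1 : 2 * Z / n = 2 * δ₀ ρ c * √(M : ℝ) / (n * ((n : ℝ) - 1)) * Real.log (2 / η) := by
      rw [hZ]; field_simp
    rw [h1]
    gcongr
    have : 0 ≤ 3 * Real.exp 1 * d * c / (1 - ρ) := by positivity
    linarith
  -- For each `r`, the chain is: uniform upper bound at the selected estimator, optimality of the
  -- selected rank, optimality of `Ahat r` against the risk minimizer `Qs r`, then the deviation at
  -- `Qs r`. The penalty of `r` appears once from the selection and once as a bound for the last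
  -- deviation; `(1 + ρ) * C` is collected `2 + 1` times.
  have hmain : risk μ ℓ X (Ahat (rhat ω) ω) - 3 * (1 + ρ) * C -
      (√(M : ℝ) / n * (V₀ ρ c d / (2 * δ₀ ρ c)) + 2 * Z / n) ≤
      ⨅ r : Finset.Icc 1 (rBar ρ c d M n), ((⨅ Q : lowRankSet M ρ r, risk μ ℓ X Q) +
        4 * (1 + ρ) * √(4 * V₀ ρ c d * (M : ℝ) ^ 2 * (r : ℕ) * Real.log (9 * (r : ℕ) * n)
          / ((n : ℝ) - 1))) := by
    refine le_ciInf fun r => ?_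
    obtain ⟨r, hr⟩ := r
    have hrM := hIcc r hr
    have hneQ : Nonempty (lowRankSet M ρ r) := ⟨⟨Qs r, hQs r⟩⟩
    have hinf : risk μ ℓ X (Qs r) ≤ ⨅ Q : lowRankSet M ρ r, risk μ ℓ X Q :=
      le_ciInf fun Q => hQsmin r Q.2
    have hpen : 4 * (1 + ρ) * √(4 * V₀ ρ c d * (M : ℝ) ^ 2 * (r : ℕ) * Real.log (9 * (r : ℕ) * n)
          / ((n : ℝ) - 1)) = 2 * pen ρ c d M n r := by rw [pen]; ring
    have h1 := hupper _ (hIcc _ hsel) _ (hAhat _ (hIcc _ hsel) ω).1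
    have h2 := hselmin r hr
    have h3 : empRisk ℓ n (fun t => X t ω) (Ahat r ω) ≤ empRisk ℓ n (fun t => X t ω) (Qs r) :=
      (hAhat r hrM ω).2 (hQs r)
    have h4 := href r hrM
    have h5 : 2 * (1 + ρ) * M * rate ρ c d n 1 ≤ pen ρ c d M n r := by
      rw [pen_eq]
      have := rate_one_le hV hn2 (Finset.mem_Icc.1 hrM).1
      have h6 : (1 + ρ) * M * rate ρ c d n 1 ≤ (1 + ρ) * M * rate ρ c d n r := by gcongr
      have h7 : 0 ≤ (1 + ρ) * M * rate ρ c d n 1 := by positivity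
      linarith
    have h6 : (1 + ρ) * L' * confScale ρ c d n = (1 + ρ) * C := by rw [hC]; ring
    simp only
    rw [hpen]
    linarith
  have h7 : 3 * (1 + ρ) * L' * confScale ρ c d n = 3 * (1 + ρ) * C := by rw [hC]; ring
  linarith
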